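/- Let $n\ge 3$ and let $b,m,J_1,J_n>0$, $\ell\ge 0$, $\mathcal G\in\mathbb R$. The $n$-dimensional rubber Routh sphere is the nonholonomic system with configuration space $Q=\{(R,x)\in \mathrm{SO}(n)\times\mathbb R^n : x_n=b\}$ and Lagrangian $$L(R,\Omega,x,\dot x)=-\tfrac14\operatorname{tr}\big((\mathbb J\Omega+\Omega\mathbb J)\Omega\big)+\tfrac m2\|R^{-1}\dot x+\ell\,\Omega E_n\|^2-m\mathcal G\ell\,\gamma_n,$$ where $\Omega=R^{-1}\dot R$, $\mathbb J=\mathrm{diag}(J_1,\dots,J_1,J_n)$, $E_n=e_n$ is the last canonical vector of $\mathbb R^n$ and $\gamma=R^{-1}e_n$, subject to the constraints of rolling without slipping, $\dot x=b\,\omega e_n$, and without spinning, $\omega_{ij}=0$ for $1\le i,j\le n-1$, where $\omega=\dot RR^{-1}$; these define the constraint distribution $D\subset TQ$. The motion is governed by the Lagrange–d'Alembert principle. The group $\mathrm{SE}(n-1)$ acts on $Q$ by $(R,x)\mapsto (hR,hx+y)$, where $h\in \mathrm{SO}(n)$, $he_n=e_n$, $y_n=0$; the orbit projection is $(R,x)\mapsto\gamma\in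 \mathrm S^{n-1}$. Through the reduced Legendre transformation, $\langle p,w\rangle=\frac{\partial L}{\partial\dot q}(q,\dot q)\cdot\mathrm{hor}_q(w)$ for $w\in T_\gamma \mathrm S^{n-1}$, where $\mathrm{hor}_q(w)$ is the vector of $D_q$ that projects to $w$, the motions descend to the solutions $z(t)=(\gamma(t),p(t))$ of the reduced equations $\dot z=X(z)$ of a smooth vector field $X$ on $T^*\mathrm S^{n-1}$, and the energy descends to the reduced Hamiltonian $H:T^*\mathrm S^{n-1}\to\mathbb R$. Then: (i) The flow of $X$ preserves the measure $$\mu=\big(2J_1+(J_n-J_1)\gamma_n^2+m(b+\ell\gamma_n)^2\big)^{\frac{2-n}{2}}\,\nu ,$$ where $\nu$ is the Liouville volume on $T^*\mathrm S^{n-1}$. (ii) The reduced equations become Hamiltonian after the time reparametrisation $$dt=\rho(\gamma)\,d\tau,\qquad \rho(\gamma)=\sqrt{2J_1+(J_n-J_1)\gamma_n^2+m(b+\ell\gamma_n)^2}.$$ Precisely, in the time $\tau$ and with the rescaled momentum $\tilde p=p/\rho(\gamma)$, their solutions solve the canonical Hamilton equations on $T^*\mathrm S^{n-1}$ of the Hamiltonian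 $\tilde H(\gamma,\tilde p)=H(\gamma,\rho(\gamma)\tilde p)$. -/

import Mathlib

open Set
open scoped Matrix ContDiff

noncomputable section

namespace RubberRouth

/-!  The space dimension is `n = d + 1`, so the shape space, the unit sphere of `ℝⁿ`, has
dimension `d`. The Euclidean scalar product is `⬝ᵥ`. -/

/-- `ℝⁿ` with `n = d + 1`. -/
abbrev Vec (d : ℕ) := Fin (d + 1) → ℝ

/-- Real `n × n` matrices, `n = d + 1`. -/
abbrev Mat (d : ℕ) := Matrix (Fin (d + 1)) (Fin (d + 1)) ℝ

/-- The ambient space `ℝ^{n×n} × ℝⁿ` of the configuration space; its elements are used both for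
positions `(R, x)` and for tangent vectors `(δR, δx)`. -/
abbrev Amb (d : ℕ) := Mat d × Vec d

/-- The ambient space `ℝⁿ × ℝⁿ` of the cotangent bundle of the sphere. -/
abbrev Phase (d : ℕ) := Vec d × Vec d

/-- The last vector of the canonical basis: `e_n` in the space frame, `E_n` in the body frame. -/
def eLast (d : ℕ) : Vec d := Pi.single (Fin.last d) 1

/-- The physical constants of the sphere: radius `b`, mass `m`, distance `ℓ` from the centre of
mass to the geometric centre, entries `J₁, Jₙ` of the mass tensor, gravitational constant `g`. -/
structure Params where
  b : ℝ
  m : ℝ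
  ℓ : ℝ
  J₁ : ℝ
  Jₙ : ℝ
  g : ℝ

variable {d : ℕ}

/-! ### The mechanical system -/

/-- The configuration space `Q = SO(n) × {x ∈ ℝⁿ : x_n = b}`. -/
def IsConfig (S : Params) (q : Amb d) : Prop :=
  q.1 ∈ Matrix.specialOrthogonalGroup (Fin (d + 1)) ℝ ∧ q.2 (Fin.last d) = S.b

/-- The Poisson vector `γ = R⁻¹ e_n` (with `R⁻¹ = Rᵀ`). -/
def poisson (q : Amb d) : Vec d := q.1ᵀ *ᵥ eLast d

/-- The velocity `γ̇ = (δR)ᵀ e_n` of the Poisson vector along a tangent vector `(δR, δx)`. -/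
def poissonVel (v : Amb d) : Vec d := v.1ᵀ *ᵥ eLast d

/-- The constraint distribution `D_q`: the vectors `v = (Ṙ, ẋ)` tangent to `Q` which satisfy,
with the space angular velocity `ω = Ṙ R⁻¹`, the rolling constraint `ẋ = b ω e_n` and the
rubber constraint `ω_{ij} = 0` for `i, j ≤ n - 1`. -/
def Dist (S : Params) (q v : Amb d) : Prop :=
  (v.1 * q.1ᵀ)ᵀ = -(v.1 * q.1ᵀ) ∧
  v.2 (Fin.last d) = 0 ∧
  v.2 = S.b • ((v.1 * q.1ᵀ) *ᵥ eLast d) ∧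
  ∀ i j : Fin (d + 1), i ≠ Fin.last d → j ≠ Fin.last d → (v.1 * q.1ᵀ) i j = 0

/-- The mass tensor `diag(J₁, …, J₁, Jₙ)`. -/
def massTensor (S : Params) : Mat d :=
  Matrix.diagonal fun i => if i = Fin.last d then S.Jₙ else S.J₁

/-- The inertia tensor `𝕀 Ω = 𝕁 Ω + Ω 𝕁`. -/
def inertia (S : Params) (Ω : Mat d) : Mat d := massTensor S * Ω + Ω * massTensor S

/-- The Killing metric `(ξ, η)_κ = -½ tr(ξ η)`. -/
def killing (ξ η : Mat d) : ℝ := -(1 / 2) * (ξ * η).trace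

/-- The Lagrangian
`½ (𝕀Ω, Ω)_κ + (m/2) ‖R⁻¹ ẋ + ℓ Ω E_n‖² - m g ℓ γ_n`, `Ω = R⁻¹ Ṙ`, at position `q = (R, x)` and
velocity `v = (Ṙ, ẋ)`, written with `R⁻¹ = Rᵀ` so that it is a polynomial on the ambient space. -/
def lagrangian (S : Params) (q v : Amb d) : ℝ :=
  1 / 2 * killing (inertia S (q.1ᵀ * v.1)) (q.1ᵀ * v.1)
    + S.m / 2 *
      ((q.1ᵀ *ᵥ v.2 + S.ℓ • ((q.1ᵀ * v.1) *ᵥ eLast d)) ⬝ᵥ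
        (q.1ᵀ *ᵥ v.2 + S.ℓ • ((q.1ᵀ * v.1) *ᵥ eLast d)))
    - S.m * S.g * S.ℓ * poisson q (Fin.last d)

/-- The fibre derivative `∂L/∂q̇ (q, v) · δ`. -/
def velDeriv (S : Params) (q v δ : Amb d) : ℝ :=
  deriv (fun ε : ℝ => lagrangian S q (v + ε • δ)) 0

/-- The base derivative `∂L/∂q (q, v) · δ`. -/
def posDeriv (S : Params) (q v δ : Amb d) : ℝ :=
  deriv (fun ε : ℝ => lagrangian S (q + ε • δ) v) 0

/-- The energy `∂L/∂q̇ · q̇ - L`. -/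
def energy (S : Params) (q v : Amb d) : ℝ := velDeriv S q v v - lagrangian S q v

/-- The (entrywise) velocity of a curve in the ambient space. -/
def velocity (q : ℝ → Amb d) (t : ℝ) : Amb d :=
  (Matrix.of fun i j => deriv (fun s => (q s).1 i j) t, fun i => deriv (fun s => (q s).2 i) t)

/-- `q` is a motion of the nonholonomic system on the time interval `(t₀, t₁)`: a `C²` curve in `Q`
which satisfies the constraints and the Lagrange–d'Alembert principle
`(d/dt ∂L/∂q̇ - ∂L/∂q) · δ = 0` for every virtual displacement `δ ∈ D_{q(t)}`. As `δ` is tangent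
to `Q`, this does not depend on how `L` is extended to the ambient space. -/
structure IsMotion (S : Params) (q : ℝ → Amb d) (t₀ t₁ : ℝ) : Prop where
  contDiff_rot : ∀ i j, ContDiffOn ℝ 2 (fun t => (q t).1 i j) (Ioo t₀ t₁)
  contDiff_pos : ∀ i, ContDiffOn ℝ 2 (fun t => (q t).2 i) (Ioo t₀ t₁)
  config : ∀ t ∈ Ioo t₀ t₁, IsConfig S (q t)
  constraint : ∀ t ∈ Ioo t₀ t₁, Dist S (q t) (velocity q t)
  dAlembert : ∀ t ∈ Ioo t₀ t₁, ∀ δ : Amb d, Dist S (q t) δ →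
    HasDerivAt (fun s => velDeriv S (q s) (velocity q s) δ)
      (posDeriv S (q t) (velocity q t) δ) t

/-! ### Reduction to the cotangent bundle of the sphere -/

/-- The action of `SE(n-1)` on `Q`: `q'` lies in the orbit of `q = (R, x)` if `q' = (hR, hx + y)`
for some `h ∈ SO(n)` with `h e_n = e_n` and some `y ∈ ℝⁿ` with `y_n = 0`. -/
def SameOrbit (q q' : Amb d) : Prop :=
  ∃ h ∈ Matrix.specialOrthogonalGroup (Fin (d + 1)) ℝ, ∃ y : Vec d,
    h *ᵥ eLast d = eLast d ∧ y (Fin.last d) = 0 ∧ q' = (h * q.1, h *ᵥ q.2 + y)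

/-- The Poisson vector is the orbit projection `Q → Q/SE(n-1) = S^{n-1}`. -/
theorem poisson_eq_iff_sameOrbit (S : Params) (q q' : Amb d) (hq : IsConfig S q)
    (hq' : IsConfig S q') : poisson q = poisson q' ↔ SameOrbit q q' := by
  have hR := (Matrix.mem_specialOrthogonalGroup_iff.mp hq.1)
  have hR' := (Matrix.mem_specialOrthogonalGroup_iff.mp hq'.1)
  have o : ∀ {A : Mat d}, A ∈ Matrix.orthogonalGroup (Fin (d + 1)) ℝ → Aᵀ * A = 1 ∧ A * Aᵀ = 1 :=
    fun h => ⟨(Matrix.mem_orthogonalGroup_iff' _ _).mp h, (Matrix.mem_orthogonalGroup_iff _ _).mp h⟩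
  have fix : ∀ {h : Mat d}, h ∈ Matrix.orthogonalGroup (Fin (d + 1)) ℝ →
      h *ᵥ eLast d = eLast d → hᵀ *ᵥ eLast d = eLast d := by
    intro h hh he
    conv_lhs => rw [← he]
    rw [Matrix.mulVec_mulVec, (o hh).1, Matrix.one_mulVec]
  constructor
  · intro heq
    have hmem : q'.1 * q.1ᵀ ∈ Matrix.specialOrthogonalGroup (Fin (d + 1)) ℝ := by
      rw [Matrix.mem_specialOrthogonalGroup_iff]
      refine ⟨?_, by rw [Matrix.det_mul, Matrix.det_transpose, hR.2, hR'.2, one_mul]⟩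
      rw [Matrix.mem_orthogonalGroup_iff]
      change q'.1 * q.1ᵀ * (q'.1 * q.1ᵀ)ᵀ = 1
      rw [Matrix.transpose_mul, Matrix.transpose_transpose, Matrix.mul_assoc,
        ← Matrix.mul_assoc q.1ᵀ, (o hR.1).1, Matrix.one_mul, (o hR'.1).2]
    have he : (q'.1 * q.1ᵀ) *ᵥ eLast d = eLast d := by
      rw [← Matrix.mulVec_mulVec]
      change q'.1 *ᵥ poisson q = _
      rw [heq, poisson, Matrix.mulVec_mulVec, (o hR'.1).2, Matrix.one_mulVec]
    refine ⟨q'.1 * q.1ᵀ, hmem, q'.2 - (q'.1 * q.1ᵀ) *ᵥ q.2, he, ?_, ?_⟩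
    · have h1 : ∀ v : Vec d, v (Fin.last d) = eLast d ⬝ᵥ v := fun v => by simp [eLast]
      rw [Pi.sub_apply, hq'.2, h1 ((q'.1 * q.1ᵀ) *ᵥ q.2), Matrix.dotProduct_mulVec,
        ← Matrix.mulVec_transpose, fix (Matrix.mem_specialOrthogonalGroup_iff.mp hmem).1 he,
        ← h1, hq.2, sub_self]
    · ext1
      · change q'.1 = _ * _
        rw [Matrix.mul_assoc, (o hR.1).1, Matrix.mul_one]
      · simp
  · rintro ⟨h, hh, y, he, -, rfl⟩
    have := fix (Matrix.mem_specialOrthogonalGroup_iff.mp hh).1 he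
    simp only [poisson, Matrix.transpose_mul]
    rw [← Matrix.mulVec_mulVec, this]

/-- `T*S^{n-1}`, a covector at `γ` being identified with a vector `p ⟂ γ` through the Euclidean
scalar product. -/
def cotangentSphere (d : ℕ) : Set (Phase d) :=
  {z | z.1 ⬝ᵥ z.1 = 1 ∧ z.1 ⬝ᵥ z.2 = 0}

/-- `z = (γ, p)` is the point of `T*S^{n-1}` represented by the state `(q, v)`, `v ∈ D_q`:
`γ` is the orbit of `q`, and `p` is the image of `v` under the reduced Legendre transformation,
`p · w = ∂L/∂q̇ (q, v) · hor_q(w)` for `w ∈ T_γ S^{n-1}`; here `hor_q(w)` is the vector `δ ∈ D_q`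
over `w`. -/
def IsReducedState (S : Params) (q v : Amb d) (z : Phase d) : Prop :=
  z ∈ cotangentSphere d ∧ z.1 = poisson q ∧
  ∀ δ : Amb d, Dist S q δ → z.2 ⬝ᵥ poissonVel δ = velDeriv S q v δ

/-- `X` is the reduced vector field on `T*S^{n-1}`: it is smooth, and the motions of the
nonholonomic system, which exist for all initial states in `D`, project to solutions of
`ż = X(z)`. (Only the values of `X` on `T*S^{n-1}` matter, and they are determined by this.) -/
structure IsReducedVectorField (S : Params) (X : Phase d → Phase d) : Prop where
  smooth : ∃ U : Set (Phase d), IsOpen U ∧ cotangentSphere d ⊆ U ∧ ContDiffOn ℝ ∞ X U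
  exists_motion : ∀ q₀ v₀ : Amb d, IsConfig S q₀ → Dist S q₀ v₀ →
    ∃ ε > 0, ∃ q : ℝ → Amb d, IsMotion S q (-ε) ε ∧ q 0 = q₀ ∧ velocity q 0 = v₀
  projects : ∀ (q : ℝ → Amb d) (z : ℝ → Phase d) (t₀ t₁ : ℝ), IsMotion S q t₀ t₁ →
    (∀ t ∈ Ioo t₀ t₁, IsReducedState S (q t) (velocity q t) (z t)) →
    ∀ t ∈ Ioo t₀ t₁, HasDerivAt z (X (z t)) t

/-- `H` is the reduced Hamiltonian on `T*S^{n-1}`, i.e. the energy of the states in `D`. -/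
def IsReducedHamiltonian (S : Params) (H : Phase d → ℝ) : Prop :=
  ∀ (q v : Amb d) (z : Phase d), IsConfig S q → Dist S q v → IsReducedState S q v z →
    H z = energy S q v

/-! ### Symplectic geometry of `T*S^{n-1}` -/

/-- The canonical symplectic form `Σ dγ_i ∧ dp_i`, to be restricted to tangent vectors of
`T*S^{n-1}`. -/
def symp (w w' : Phase d) : ℝ := w.1 ⬝ᵥ w'.2 - w'.1 ⬝ᵥ w.2

/-- The density `|ω^d / d!|(w₁, …, w_{2d}) = √det(ω(wᵢ, wⱼ))` of the Liouville volume `ν`, on tangent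
vectors of `T*S^{n-1}` (it is `1` on the frames of canonical coordinates `(s, p)`). -/
def liouville (w : Fin (2 * d) → Phase d) : ℝ :=
  Real.sqrt (Matrix.det (Matrix.of fun i j => symp (w i) (w j)))

/-- The flow of `ż = X(z)` on `T*S^{n-1}` preserves the measure `f ν`: for every smooth
`2d`-parameter family `z = F(t, u)` of solutions, the density `f · ν(∂F/∂u₁, …, ∂F/∂u_{2d})` of the
measure in the parameters `u` does not depend on the time `t`. -/
def PreservesMeasure (X : Phase d → Phase d) (f : Phase d → ℝ) : Prop :=
  ∀ (t₀ t₁ : ℝ) (W : Set (Fin (2 * d) → ℝ)) (F : ℝ × (Fin (2 * d) → ℝ) → Phase d),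
    IsOpen W → ContDiffOn ℝ ∞ F (Ioo t₀ t₁ ×ˢ W) →
    (∀ t ∈ Ioo t₀ t₁, ∀ u ∈ W, F (t, u) ∈ cotangentSphere d ∧
      HasDerivAt (fun s => F (s, u)) (X (F (t, u))) t) →
    ∀ t ∈ Ioo t₀ t₁, ∀ t' ∈ Ioo t₀ t₁, ∀ u ∈ W,
      f (F (t, u)) *
          liouville (fun i => fderiv ℝ (fun u' => F (t, u')) u (Pi.single i 1)) =
        f (F (t', u)) *
          liouville (fun i => fderiv ℝ (fun u' => F (t', u')) u (Pi.single i 1))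

/-- `ζ` solves on `(τ₀, τ₁)` the canonical Hamilton equations `ω(ζ', ·) = dK` on `T*S^{n-1}`; the
tangent vectors on which the two sides are compared are the velocities of smooth curves `c` in
`T*S^{n-1}`. -/
def SolvesHamilton (K : Phase d → ℝ) (ζ : ℝ → Phase d) (τ₀ τ₁ : ℝ) : Prop :=
  ∀ τ ∈ Ioo τ₀ τ₁, ζ τ ∈ cotangentSphere d ∧ ∃ ζ' : Phase d, HasDerivAt ζ ζ' τ ∧
    ∀ c : ℝ → Phase d, ContDiff ℝ ∞ c → (∀ s, c s ∈ cotangentSphere d) → c 0 = ζ τ →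
      HasDerivAt (fun s => K (c s)) (symp ζ' (deriv c 0)) 0

/-- The system `ż = X(z)` with energy `H` becomes Hamiltonian after the time reparametrisation
`dt = ρ(γ) dτ`: in the time `τ` and with the rescaled momenta `p̃ = p / ρ(γ)`, its solutions solve
the canonical Hamilton equations of `H̃(γ, p̃) = H(γ, ρ(γ) p̃)`. -/
def HamiltonianAfter (X : Phase d → Phase d) (H : Phase d → ℝ) (ρ : Vec d → ℝ) : Prop :=
  ∀ (z : ℝ → Phase d) (t₀ t₁ : ℝ) (θ : ℝ → ℝ) (τ₀ τ₁ : ℝ),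
    (∀ t ∈ Ioo t₀ t₁, z t ∈ cotangentSphere d ∧ HasDerivAt z (X (z t)) t) →
    (∀ τ ∈ Ioo τ₀ τ₁, θ τ ∈ Ioo t₀ t₁ ∧ HasDerivAt θ (ρ (z (θ τ)).1) τ) →
    SolvesHamilton (fun y => H (y.1, ρ y.1 • y.2))
      (fun τ => ((z (θ τ)).1, (ρ (z (θ τ)).1)⁻¹ • (z (θ τ)).2)) τ₀ τ₁

/-- The function `2J₁ + (Jₙ - J₁) γ_n² + m (b + ℓ γ_n)²`. -/
def multiplier (S : Params) (γ : Vec d) : ℝ :=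
  2 * S.J₁ + (S.Jₙ - S.J₁) * γ (Fin.last d) ^ 2 + S.m * (S.b + S.ℓ * γ (Fin.last d)) ^ 2

end RubberRouth

end

/-! Notation: `A` is `multiplier`, `C` is `axisInertia`, `B = A + C (1 - γ_n²)` is `tiltInertia`, `w
= γ̇`, and `ρ² = A`. The rubber constraint leaves only the last row and column of the skew matrix
`ω`, so `D_q` is a copy of `T_γ S^{n-1}`: the vector over `w` has `Ω = γ ∧ w` and `ẋ = -b R w`
(`Dist.eq_horLift`). On `D` the kinetic energy is `½ (A |w|² + C w_n²)`. Hence `p = A w + C w_n (e_n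
- γ_n γ)` and `p_n = B w_n`, which makes the Legendre transformation explicitly invertible. The
Lagrange–d'Alembert principle becomes `ṗ = m b ℓ w_n w - m g ℓ (e_n - γ_n γ) - (p · w) γ`
(`hasDerivAt_velDeriv`). This gives `redField`; motions with any initial state in `D` come from an
ODE for `(R, x, p)` (`exists_motion`).

Part (ii): compared with the canonical equations of `H`, the extra force is, modulo `γ`, `(d ln ρ ·
w) p - (p · w) d ln ρ`. With `p = ρ p̃` and `dt = ρ dτ`, the first term is the derivative of the
factor `ρ`, and the second is the difference between the `γ`-derivatives of `H̃` and `H`.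
Concretely, the kinetic part of `H̃` is `½ (|p̃|² - C p̃_n² / B)`, in which `A` no longer appears,
and `B` is affine in `γ_n`. `hamiltonianAfter_timeScale` verifies Hamilton's equations on an
arbitrary tangent vector.

Part (i): the density agrees with (ii), since the canonical volume in `(γ, p̃)` is `ρ^{-d} ν` and
the time change contributes a factor `ρ`. The proof is nevertheless direct. A tangent frame carried
by the linearised flow is completed by two normal vectors, and its Liouville density becomes a
constant times the absolute value of an ambient determinant (`liouville_eq`). By Liouville's formula
this determinant has logarithmic derivative `(d - 1)/2 · Ȧ/A` (`trace_transport`), which the power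
`(1 - d)/2` of `A` cancels. -/

noncomputable section

namespace RubberRouth

variable {d : ℕ}

/-! ### Derivatives of the Lagrangian, and horizontal lifts -/

section

open Matrix

/-- The bivector `a ∧ b = a bᵀ - b aᵀ`. -/
def wedge (a b : Vec d) : Mat d := vecMulVec a b - vecMulVec b a

/-- `R⁻¹ ẋ + ℓ Ω E_n`, the velocity of the centre of mass in the body frame. -/
def bodyVel (S : Params) (q v : Amb d) : Vec d :=
  q.1ᵀ *ᵥ v.2 + S.ℓ • ((q.1ᵀ * v.1) *ᵥ eLast d)

lemma dotProduct_eLast (v : Vec d) : v ⬝ᵥ eLast d = v (Fin.last d) := by simp [eLast]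

lemma eLast_dotProduct (v : Vec d) : eLast d ⬝ᵥ v = v (Fin.last d) := by simp [eLast]

lemma eLast_last : eLast d (Fin.last d) = 1 := by simp [eLast]

lemma wedge_mulVec (a b c : Vec d) : wedge a b *ᵥ c = (b ⬝ᵥ c) • a - (a ⬝ᵥ c) • b := by
  simp [wedge, sub_mulVec, vecMulVec_mulVec]

lemma wedge_transpose (a b : Vec d) : (wedge a b)ᵀ = -wedge a b := by
  simp [wedge, transpose_vecMulVec]

/-- The mass tensor is `J₁` times the identity plus `(Jₙ - J₁) e_n e_nᵀ`. Every inertia term thereby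
becomes a polynomial in scalar products and last entries. -/
lemma massTensor_mulVec_dotProduct (S : Params) (a b : Vec d) :
    (massTensor S *ᵥ a) ⬝ᵥ b =
      S.J₁ * (a ⬝ᵥ b) + (S.Jₙ - S.J₁) * a (Fin.last d) * b (Fin.last d) := by
  simp only [massTensor, mulVec_diagonal, dotProduct, Finset.mul_sum]
  rw [Fin.sum_univ_castSucc, Fin.sum_univ_castSucc (f := fun i => S.J₁ * (a i * b i))]
  simp only [Fin.castSucc_ne_last, if_false, if_true, mul_assoc]
  ring

lemma killing_inertia_comm (S : Params) (A B : Mat d) :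
    killing (inertia S A) B = killing (inertia S B) A := by
  simp only [killing, inertia, add_mul, trace_add]
  rw [trace_mul_comm (massTensor S * A) B, trace_mul_comm (A * massTensor S) B, ← mul_assoc,
    ← mul_assoc, mul_assoc (massTensor S) B A, trace_mul_comm (massTensor S) (B * A),
    mul_assoc B A]
  ring

lemma killing_inertia_add_left (S : Params) (A A' B : Mat d) :
    killing (inertia S (A + A')) B = killing (inertia S A) B + killing (inertia S A') B := by
  simp only [killing, inertia, mul_add, add_mul, trace_add]
  ring

lemma killing_inertia_smul_left (S : Params) (c : ℝ) (A B : Mat d) :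
    killing (inertia S (c • A)) B = c * killing (inertia S A) B := by
  simp only [killing, inertia, add_mul, trace_add, Matrix.mul_smul, smul_mul, trace_smul, smul_eq_mul]
  ring

lemma killing_inertia_add_right (S : Params) (A B B' : Mat d) :
    killing (inertia S A) (B + B') = killing (inertia S A) B + killing (inertia S A) B' := by
  simp only [killing, mul_add, trace_add]

lemma killing_inertia_smul_right (S : Params) (c : ℝ) (A B : Mat d) :
    killing (inertia S A) (c • B) = c * killing (inertia S A) B := by
  simp only [killing, Matrix.mul_smul, trace_smul, smul_eq_mul]
  ring

lemma killing_inertia_wedge (S : Params) (a b c e : Vec d) :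
    killing (inertia S (wedge a b)) (wedge c e) =
      (a ⬝ᵥ c) * ((massTensor S *ᵥ b) ⬝ᵥ e) + (b ⬝ᵥ e) * ((massTensor S *ᵥ a) ⬝ᵥ c)
        - (a ⬝ᵥ e) * ((massTensor S *ᵥ b) ⬝ᵥ c) - (b ⬝ᵥ c) * ((massTensor S *ᵥ a) ⬝ᵥ e) := by
  have h : ∀ u v : Vec d, u ᵥ* massTensor S ⬝ᵥ v = (massTensor S *ᵥ u) ⬝ᵥ v := fun u v => by
    rw [← mulVec_transpose]; simp [massTensor]
  simp only [killing, inertia, wedge, mul_sub, sub_mul, add_mul, mul_vecMulVec, vecMulVec_mul,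
    trace_add, trace_sub, trace_vecMulVec, vecMulVec_mulVec, op_smul_eq_smul, smul_dotProduct,
    smul_eq_mul, h]
  simp only [massTensor_mulVec_dotProduct]
  ring

lemma lagrangian_eq (S : Params) (q v : Amb d) :
    lagrangian S q v = 1 / 2 * killing (inertia S (q.1ᵀ * v.1)) (q.1ᵀ * v.1)
      + S.m / 2 * (bodyVel S q v ⬝ᵥ bodyVel S q v) - S.m * S.g * S.ℓ * poisson q (Fin.last d) :=
  rfl

lemma bodyVel_add_right (S : Params) (q v δ : Amb d) (ε : ℝ) :
    bodyVel S q (v + ε • δ) = bodyVel S q v + ε • bodyVel S q δ := by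
  simp only [bodyVel, Prod.fst_add, Prod.snd_add, Prod.smul_fst, Prod.smul_snd, mulVec_add,
    mul_add, add_mulVec, mulVec_smul, Matrix.mul_smul, smul_mulVec, smul_add, smul_comm ε S.ℓ]
  abel

lemma bodyVel_add_left (S : Params) (q v δ : Amb d) (ε : ℝ) :
    bodyVel S (q + ε • δ) v = bodyVel S q v + ε • bodyVel S δ v := by
  simp only [bodyVel, Prod.fst_add, Prod.smul_fst, transpose_add,
    transpose_smul, add_mul, add_mulVec, smul_mul, smul_mulVec, smul_add, smul_comm ε S.ℓ]
  abel

/-- With `R⁻¹` replaced by `Rᵀ`, the Lagrangian is a quadratic polynomial along lines both in the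
velocity and in the position, so both of its derivatives are read off as linear coefficients. -/
lemma deriv_quadratic (a b c : ℝ) : deriv (fun ε : ℝ => a + ε * b + ε ^ 2 * c) 0 = b := by
  have h := (((hasDerivAt_id (0 : ℝ)).mul_const b).const_add a).fun_add
    (((hasDerivAt_id (0 : ℝ)).pow 2).mul_const c)
  simpa using h.deriv

lemma velDeriv_eq (S : Params) (q v δ : Amb d) :
    velDeriv S q v δ = killing (inertia S (q.1ᵀ * v.1)) (q.1ᵀ * δ.1)
      + S.m * (bodyVel S q v ⬝ᵥ bodyVel S q δ) := by
  rw [velDeriv, ← deriv_quadratic (lagrangian S q v) (_ + _)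
    (1 / 2 * killing (inertia S (q.1ᵀ * δ.1)) (q.1ᵀ * δ.1)
      + S.m / 2 * (bodyVel S q δ ⬝ᵥ bodyVel S q δ))]
  congr 1
  funext ε
  simp only [lagrangian_eq, bodyVel_add_right, Prod.fst_add, Prod.smul_fst, mul_add, Matrix.mul_smul,
    killing_inertia_add_left, killing_inertia_add_right, killing_inertia_smul_left,
    killing_inertia_smul_right, dotProduct_add, add_dotProduct, smul_dotProduct, dotProduct_smul,
    smul_eq_mul]
  rw [killing_inertia_comm S (q.1ᵀ * δ.1) (q.1ᵀ * v.1),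
    dotProduct_comm (bodyVel S q δ) (bodyVel S q v)]
  ring

lemma posDeriv_eq (S : Params) (q v δ : Amb d) :
    posDeriv S q v δ = killing (inertia S (q.1ᵀ * v.1)) (δ.1ᵀ * v.1)
      + S.m * (bodyVel S q v ⬝ᵥ bodyVel S δ v)
      - S.m * S.g * S.ℓ * poisson δ (Fin.last d) := by
  rw [posDeriv, ← deriv_quadratic (lagrangian S q v) (_ - _)
    (1 / 2 * killing (inertia S (δ.1ᵀ * v.1)) (δ.1ᵀ * v.1)
      + S.m / 2 * (bodyVel S δ v ⬝ᵥ bodyVel S δ v))]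
  congr 1
  funext ε
  simp only [lagrangian_eq, bodyVel_add_left, Prod.fst_add, Prod.smul_fst, transpose_add,
    transpose_smul, add_mul, smul_mul, poisson, mul_add, add_mulVec, smul_mulVec, Pi.add_apply,
    Pi.smul_apply,
    killing_inertia_add_left, killing_inertia_add_right, killing_inertia_smul_left,
    killing_inertia_smul_right, dotProduct_add, add_dotProduct, smul_dotProduct, dotProduct_smul,
    smul_eq_mul]
  rw [killing_inertia_comm S (δ.1ᵀ * v.1) (q.1ᵀ * v.1),
    dotProduct_comm (bodyVel S δ v) (bodyVel S q v)]
  ring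

lemma IsConfig.orthogonal {S : Params} {q : Amb d} (hq : IsConfig S q) :
    q.1ᵀ * q.1 = 1 ∧ q.1 * q.1ᵀ = 1 :=
  have h := (mem_specialOrthogonalGroup_iff.mp hq.1).1
  ⟨(mem_orthogonalGroup_iff' _ _).mp h, (mem_orthogonalGroup_iff _ _).mp h⟩

lemma poisson_dotProduct_self {q : Amb d} (h : q.1 * q.1ᵀ = 1) : poisson q ⬝ᵥ poisson q = 1 := by
  rw [poisson, dotProduct_mulVec, vecMul_transpose, mulVec_mulVec, h, one_mulVec]
  simp [eLast]

lemma mulVec_poisson {q : Amb d} (h : q.1 * q.1ᵀ = 1) : q.1 *ᵥ poisson q = eLast d := by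
  rw [poisson, mulVec_mulVec, h, one_mulVec]

/-- The vector of `D_q` over `w`. -/
def horLift (S : Params) (q : Amb d) (w : Vec d) : Amb d :=
  (q.1 * wedge (poisson q) w, -(S.b • (q.1 *ᵥ w)))

lemma mul_wedge_mul_transpose (A : Mat d) (a b : Vec d) :
    A * wedge a b * Aᵀ = wedge (A *ᵥ a) (A *ᵥ b) := by
  simp [wedge, mul_sub, sub_mul, mul_vecMulVec, vecMulVec_mul, vecMul_transpose]

lemma dist_horLift {S : Params} {q : Amb d} (hq : IsConfig S q) {w : Vec d}
    (hw : poisson q ⬝ᵥ w = 0) : Dist S q (horLift S q w) := by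
  obtain ⟨-, h⟩ := hq.orthogonal
  have hl : (q.1 *ᵥ w) (Fin.last d) = 0 := by
    rw [← eLast_dotProduct (q.1 *ᵥ w), dotProduct_mulVec, ← mulVec_transpose]; exact hw
  simp only [Dist, horLift, mul_wedge_mul_transpose, mulVec_poisson h, wedge_transpose, true_and,
    wedge_mulVec, dotProduct_eLast, eLast_last, hl]
  refine ⟨by simp [hl], by simp, fun i j hi hj => ?_⟩
  simp [wedge, vecMulVec_apply, eLast, hi, hj]

/-- A skew `ω` whose block of indices below `n` vanishes is determined by its last column: `ω = e_n
∧ (-ω e_n)`. Since `R γ̇ = -ω e_n`, conjugation by `R` turns this into `Ω = γ ∧ γ̇`, and rolling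
gives `ẋ = -b R γ̇`. -/
lemma Dist.eq_horLift {S : Params} {q v : Amb d} (hq : IsConfig S q) (hv : Dist S q v) :
    v = horLift S q (poissonVel v) ∧ poisson q ⬝ᵥ poissonVel v = 0 := by
  obtain ⟨h', h⟩ := hq.orthogonal
  obtain ⟨hs, -, hr, hz⟩ := hv
  set W := v.1 * q.1ᵀ with hW
  have hV : v.1 = W * q.1 := by rw [hW, mul_assoc, h', mul_one]
  have hsk : ∀ i j, W j i = -W i j := fun i j => congrFun (congrFun hs i) j
  have hwe : W = wedge (eLast d) (-(W *ᵥ eLast d)) := by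
    ext i j
    have hu : ∀ i, (W *ᵥ eLast d) i = W i (Fin.last d) := fun i => by
      simp [mulVec, dotProduct_eLast]
    simp only [wedge, Matrix.sub_apply, vecMulVec_apply, Pi.neg_apply, hu]
    have h0 := hsk (Fin.last d) (Fin.last d)
    by_cases hi : i = Fin.last d <;> by_cases hj : j = Fin.last d
    · subst hi hj; linarith
    · subst hi; simp [eLast, hj, hsk j]
    · subst hj; simp [eLast, hi]
    · simp [eLast, hi, hj, hz i j hi hj]
  have hpv : poissonVel v = -(q.1ᵀ *ᵥ (W *ᵥ eLast d)) := by
    rw [poissonVel, hV, transpose_mul, hs, ← mulVec_mulVec, neg_mulVec, mulVec_neg]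
  have hqp : q.1 *ᵥ poissonVel v = -(W *ᵥ eLast d) := by
    rw [hpv, mulVec_neg, mulVec_mulVec, h, one_mulVec]
  refine ⟨Prod.ext ?_ ?_, ?_⟩
  · have := mul_wedge_mul_transpose q.1 (poisson q) (poissonVel v)
    rw [mulVec_poisson h, hqp, ← hwe] at this
    rw [hV, ← this, horLift, mul_assoc, h', mul_one]
  · rw [hr, horLift, hqp, smul_neg, neg_neg]
  · rw [poisson, mulVec_transpose, ← dotProduct_mulVec, hqp, eLast_dotProduct]
    have := hsk (Fin.last d) (Fin.last d)
    simp only [Pi.neg_apply, mulVec, dotProduct_eLast]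
    linarith

lemma poissonVel_horLift {S : Params} {q : Amb d} (h : q.1 * q.1ᵀ = 1) {w : Vec d}
    (hw : poisson q ⬝ᵥ w = 0) : poissonVel (horLift S q w) = w := by
  rw [poissonVel, horLift, transpose_mul, wedge_transpose, ← mulVec_mulVec, neg_mulVec]
  change -(wedge (poisson q) w *ᵥ poisson q) = w
  rw [wedge_mulVec, poisson_dotProduct_self h, dotProduct_comm, hw]
  simp

end

/-! ### Calculus of matrix curves, and the reduced Legendre transformation -/

section

open Matrix
lemma hasDerivAt_matrix {m n : Type*} [Finite m] [Fintype n] {M : ℝ → Matrix m n ℝ} {M' : Matrix m n ℝ} {t : ℝ} :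
    HasDerivAt M M' t ↔ ∀ i j, HasDerivAt (fun s => M s i j) (M' i j) t :=
  hasDerivAt_pi.trans (forall_congr' fun _ => hasDerivAt_pi)

variable {m n o : Type*} [Fintype m] [Fintype n] [Fintype o]

lemma _root_.HasDerivAt.matrix_mul {M : ℝ → Matrix m n ℝ} {N : ℝ → Matrix n o ℝ}
    {M' : Matrix m n ℝ} {N' : Matrix n o ℝ} {t : ℝ}
    (hM : HasDerivAt M M' t) (hN : HasDerivAt N N' t) :
    HasDerivAt (fun s => M s * N s) (M' * N t + M t * N') t := by
  rw [hasDerivAt_matrix] at *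
  intro i j
  simp only [mul_apply, Matrix.add_apply, ← Finset.sum_add_distrib]
  exact HasDerivAt.fun_sum fun k _ => (hM i k).mul (hN k j)

lemma _root_.HasDerivAt.matrix_mulVec {M : ℝ → Matrix m n ℝ} {v : ℝ → n → ℝ}
    {M' : Matrix m n ℝ} {v' : n → ℝ} {t : ℝ}
    (hM : HasDerivAt M M' t) (hv : HasDerivAt v v' t) :
    HasDerivAt (fun s => M s *ᵥ v s) (M' *ᵥ v t + M t *ᵥ v') t := by
  rw [hasDerivAt_matrix] at hM
  rw [hasDerivAt_pi] at *
  intro i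
  simp only [mulVec, dotProduct, Pi.add_apply, ← Finset.sum_add_distrib]
  exact HasDerivAt.fun_sum fun k _ => (hM i k).mul (hv k)

lemma _root_.HasDerivAt.dotProduct {u v : ℝ → n → ℝ} {u' v' : n → ℝ} {t : ℝ}
    (hu : HasDerivAt u u' t) (hv : HasDerivAt v v' t) :
    HasDerivAt (fun s => u s ⬝ᵥ v s) (u' ⬝ᵥ v t + u t ⬝ᵥ v') t := by
  rw [hasDerivAt_pi] at *
  simp only [_root_.dotProduct, ← Finset.sum_add_distrib]
  exact HasDerivAt.fun_sum fun k _ => (hu k).mul (hv k)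

lemma _root_.HasDerivAt.vecMulVec {u : ℝ → m → ℝ} {v : ℝ → n → ℝ} {u' : m → ℝ} {v' : n → ℝ}
    {t : ℝ} (hu : HasDerivAt u u' t) (hv : HasDerivAt v v' t) :
    HasDerivAt (fun s => vecMulVec (u s) (v s)) (vecMulVec u' (v t) + vecMulVec (u t) v') t := by
  rw [hasDerivAt_pi] at hu hv
  rw [hasDerivAt_matrix]
  intro i j
  simp only [vecMulVec_apply, Matrix.add_apply]
  exact (hu i).mul (hv j)

lemma _root_.HasDerivAt.matrix_add {M N : ℝ → Matrix m n ℝ} {M' N' : Matrix m n ℝ} {t : ℝ}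
    (hM : HasDerivAt M M' t) (hN : HasDerivAt N N' t) :
    HasDerivAt (fun s => M s + N s) (M' + N') t := by
  rw [hasDerivAt_matrix] at *
  exact fun i j => (hM i j).add (hN i j)

lemma _root_.HasDerivAt.matrix_sub {M N : ℝ → Matrix m n ℝ} {M' N' : Matrix m n ℝ} {t : ℝ}
    (hM : HasDerivAt M M' t) (hN : HasDerivAt N N' t) :
    HasDerivAt (fun s => M s - N s) (M' - N') t := by
  rw [hasDerivAt_matrix] at *
  exact fun i j => (hM i j).sub (hN i j)

lemma _root_.HasDerivAt.matrix_transpose {M : ℝ → Matrix m n ℝ} {M' : Matrix m n ℝ} {t : ℝ}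
    (hM : HasDerivAt M M' t) : HasDerivAt (fun s => (M s)ᵀ) M'ᵀ t := by
  rw [hasDerivAt_matrix] at *
  exact fun i j => hM j i

lemma _root_.HasDerivAt.killing_inertia (S : Params) {M N : ℝ → Mat d} {M' N' : Mat d} {t : ℝ}
    (hM : HasDerivAt M M' t) (hN : HasDerivAt N N' t) :
    HasDerivAt (fun s => killing (inertia S (M s)) (N s))
      (killing (inertia S M') (N t) + killing (inertia S (M t)) N') t := by
  have hJ : HasDerivAt (fun _ : ℝ => massTensor (d := d) S) 0 t :=
    hasDerivAt_matrix.mpr fun i j => hasDerivAt_const t _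
  have h := hasDerivAt_matrix.mp (((hJ.matrix_mul hM).matrix_add (hM.matrix_mul hJ)).matrix_mul hN)
  have := (HasDerivAt.fun_sum (u := Finset.univ) fun i _ => h i i).const_mul (-(1 / 2 : ℝ))
  refine this.congr_deriv ?_
  simp only [killing, inertia, zero_mul, mul_zero, zero_add, add_zero, ← mul_add, ← trace_add]
  rfl

lemma _root_.HasDerivAt.wedge {u v : ℝ → Vec d} {u' v' : Vec d} {t : ℝ}
    (hu : HasDerivAt u u' t) (hv : HasDerivAt v v' t) :
    HasDerivAt (fun s => wedge (u s) (v s)) (wedge u' (v t) + wedge (u t) v') t := by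
  convert (hu.vecMulVec hv).matrix_sub (hv.vecMulVec hu) using 1
  · rfl
  · change vecMulVec u' (v t) - vecMulVec (v t) u' + (vecMulVec (u t) v' - vecMulVec v' (u t)) = _
    abel

/-- `C = Jₙ - J₁ + m ℓ²`. -/
def axisInertia (S : Params) : ℝ := S.Jₙ - S.J₁ + S.m * S.ℓ ^ 2

/-- `J₁ + Jₙ + m (b² + ℓ² + 2 b ℓ γ_n)`, the moment of inertia for a variation of `γ_n`. -/
def tiltInertia (S : Params) (γ : Vec d) : ℝ :=
  S.J₁ + S.Jₙ + S.m * (S.b ^ 2 + S.ℓ ^ 2 + 2 * S.b * S.ℓ * γ (Fin.last d))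

/-- The reduced Legendre transformation. -/
def legendre (S : Params) (γ w : Vec d) : Vec d :=
  multiplier S γ • w +
    (axisInertia S * w (Fin.last d)) • (eLast d - γ (Fin.last d) • γ)

/-- The inverse of the reduced Legendre transformation. -/
def shapeVel (S : Params) (γ p : Vec d) : Vec d :=
  (multiplier S γ)⁻¹ •
    (p - (axisInertia S * p (Fin.last d) / tiltInertia S γ) • (eLast d - γ (Fin.last d) • γ))

/-- The momentum equation solved for `ṗ`, in terms of the velocity `w`. -/
def force (S : Params) (γ p w : Vec d) : Vec d :=
  (S.m * S.b * S.ℓ * w (Fin.last d)) • w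
    - (S.m * S.g * S.ℓ) • (eLast d - γ (Fin.last d) • γ) - (p ⬝ᵥ w) • γ

/-- The reduced vector field. -/
def redField (S : Params) (z : Phase d) : Phase d :=
  (shapeVel S z.1 z.2, force S z.1 z.2 (shapeVel S z.1 z.2))

/-- The reduced Hamiltonian. -/
def redHam (S : Params) (z : Phase d) : ℝ :=
  1 / 2 * ((z.2 ⬝ᵥ z.2 - axisInertia S * z.2 (Fin.last d) ^ 2 / tiltInertia S z.1) /
      multiplier S z.1) + S.m * S.g * S.ℓ * z.1 (Fin.last d)

/-- The vector `e_n - γ_n γ` has last entry `1 - γ_n²`, so this is the factor by which the Legendre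
transformation multiplies last entries. The coefficient of `γ_n²` in the multiplier is exactly `C`;
it cancels and leaves an affine function of `γ_n`. -/
lemma tiltInertia_eq (S : Params) (γ : Vec d) :
    tiltInertia S γ = multiplier S γ + axisInertia S * (1 - γ (Fin.last d) ^ 2) := by
  simp only [tiltInertia, multiplier, axisInertia]; ring

lemma sq_last_le {γ : Vec d} (hγ : γ ⬝ᵥ γ = 1) : γ (Fin.last d) ^ 2 ≤ 1 := by
  rw [← hγ, dotProduct, sq]
  exact Finset.single_le_sum (f := fun i => γ i * γ i) (fun i _ => mul_self_nonneg _)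
    (Finset.mem_univ _)

/-- The physical constants are admissible. -/
structure Params.Pos (S : Params) : Prop where
  b : 0 < S.b
  m : 0 < S.m
  ℓ : 0 ≤ S.ℓ
  J₁ : 0 < S.J₁
  Jₙ : 0 < S.Jₙ

variable {S : Params}

/-- On the sphere the first two terms are `J₁ + J₁ (1 - γ_n²) + Jₙ γ_n²`. -/
lemma multiplier_pos (hS : S.Pos) {γ : Vec d} (hγ : γ ⬝ᵥ γ = 1) : 0 < multiplier S γ := by
  have h := sq_last_le hγ
  have h1 := mul_nonneg hS.m.le (sq_nonneg (S.b + S.ℓ * γ (Fin.last d)))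
  have h2 := mul_nonneg hS.Jₙ.le (sq_nonneg (γ (Fin.last d)))
  have h3 := mul_nonneg hS.J₁.le (sub_nonneg.mpr h)
  have h4 := hS.J₁
  rw [multiplier]
  nlinarith

/-- `b² + ℓ² + 2 b ℓ γ_n = (b + ℓ γ_n)² + ℓ² (1 - γ_n²)`. -/
lemma tiltInertia_pos (hS : S.Pos) {γ : Vec d} (hγ : γ ⬝ᵥ γ = 1) : 0 < tiltInertia S γ := by
  have h1 := mul_nonneg hS.m.le (sq_nonneg (S.b + S.ℓ * γ (Fin.last d)))
  have h2 := mul_nonneg (mul_nonneg hS.m.le (sq_nonneg S.ℓ)) (sub_nonneg.mpr (sq_last_le hγ))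
  have h3 := hS.J₁
  have h4 := hS.Jₙ
  rw [tiltInertia]
  nlinarith

lemma dotProduct_legendre {γ w : Vec d} (hγ : γ ⬝ᵥ γ = 1) (hw : γ ⬝ᵥ w = 0) :
    γ ⬝ᵥ legendre S γ w = 0 := by
  simp [legendre, dotProduct_add, dotProduct_sub, dotProduct_smul, dotProduct_eLast, hγ, hw]

lemma legendre_last (S : Params) {γ : Vec d} (w : Vec d) :
    legendre S γ w (Fin.last d) = tiltInertia S γ * w (Fin.last d) := by
  simp [legendre, tiltInertia_eq, eLast_last]; ring

lemma dotProduct_shapeVel {γ p : Vec d} (hγ : γ ⬝ᵥ γ = 1) (hp : γ ⬝ᵥ p = 0) :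
    γ ⬝ᵥ shapeVel S γ p = 0 := by
  simp [shapeVel, dotProduct_sub, dotProduct_smul, dotProduct_eLast, hγ, hp]

lemma shapeVel_last {γ : Vec d} (p : Vec d) (hA : multiplier S γ ≠ 0) (hB : tiltInertia S γ ≠ 0) :
    shapeVel S γ p (Fin.last d) = p (Fin.last d) / tiltInertia S γ := by
  simp only [shapeVel, Pi.smul_apply, Pi.sub_apply, eLast_last, smul_eq_mul]
  have := tiltInertia_eq S γ
  field_simp
  rw [this]; ring

lemma shapeVel_legendre (hS : S.Pos) {γ : Vec d} (hγ : γ ⬝ᵥ γ = 1) (w : Vec d) :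
    shapeVel S γ (legendre S γ w) = w := by
  have hA := (multiplier_pos hS hγ).ne'
  have hB := (tiltInertia_pos hS hγ).ne'
  have : axisInertia S * (tiltInertia S γ * w (Fin.last d)) / tiltInertia S γ
      = axisInertia S * w (Fin.last d) := by field_simp
  rw [shapeVel, legendre_last, this, legendre, add_sub_cancel_right, inv_smul_smul₀ hA]

lemma legendre_shapeVel (hS : S.Pos) {γ : Vec d} (hγ : γ ⬝ᵥ γ = 1) (p : Vec d) :
    legendre S γ (shapeVel S γ p) = p := by
  have hA := (multiplier_pos hS hγ).ne'
  have hB := (tiltInertia_pos hS hγ).ne'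
  rw [legendre, shapeVel_last p hA hB, shapeVel, smul_inv_smul₀ hA, mul_div_assoc,
    sub_add_cancel]

lemma dotProduct_force {γ p w : Vec d} (hγ : γ ⬝ᵥ γ = 1) (hw : γ ⬝ᵥ w = 0) :
    γ ⬝ᵥ force S γ p w = -(w ⬝ᵥ p) := by
  simp [force, dotProduct_sub, dotProduct_smul, dotProduct_eLast, hγ, hw, dotProduct_comm w]

lemma transpose_mul_horLift {q : Amb d} (h : q.1ᵀ * q.1 = 1) (w : Vec d) :
    q.1ᵀ * (horLift S q w).1 = wedge (poisson q) w := by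
  rw [horLift, ← mul_assoc, h, one_mul]

lemma bodyVel_horLift {q : Amb d} (h : q.1ᵀ * q.1 = 1) (w : Vec d) :
    bodyVel S q (horLift S q w) = -(S.b • w) +
      S.ℓ • (w (Fin.last d) • poisson q - poisson q (Fin.last d) • w) := by
  rw [bodyVel, transpose_mul_horLift h, wedge_mulVec, dotProduct_eLast, dotProduct_eLast, horLift]
  simp [mulVec_neg, mulVec_smul, mulVec_mulVec, h]

/-- The body velocity over `w` is `-(b + ℓ γ_n) w + ℓ w_n γ`, an orthogonal sum: it contributes `m
(b + ℓ γ_n)²` to the coefficient of `w · η` and `m ℓ²` to that of `w_n η_n`. The inertia of `γ ∧ w`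
supplies the other terms of `A` and `C`. -/
lemma velDeriv_horLift {q : Amb d} (hq : IsConfig S q) {w η : Vec d}
    (hw : poisson q ⬝ᵥ w = 0) (hη : poisson q ⬝ᵥ η = 0) :
    velDeriv S q (horLift S q w) (horLift S q η) = legendre S (poisson q) w ⬝ᵥ η := by
  obtain ⟨h', h⟩ := hq.orthogonal
  have hγ := poisson_dotProduct_self h
  rw [velDeriv_eq, transpose_mul_horLift h', transpose_mul_horLift h', bodyVel_horLift h',
    bodyVel_horLift h', killing_inertia_wedge]
  generalize poisson q = γ at *
  have hw' : w ⬝ᵥ γ = 0 := by rw [dotProduct_comm, hw]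
  simp only [massTensor_mulVec_dotProduct, legendre, multiplier, axisInertia, add_dotProduct,
    neg_dotProduct, smul_dotProduct, sub_dotProduct, dotProduct_add, dotProduct_neg,
    dotProduct_smul, dotProduct_sub, smul_eq_mul, hγ, hη, hw', eLast_dotProduct]
  ring

lemma energy_horLift (hS : S.Pos) {q : Amb d} (hq : IsConfig S q) {w : Vec d}
    (hw : poisson q ⬝ᵥ w = 0) :
    energy S q (horLift S q w) = redHam S (poisson q, legendre S (poisson q) w) := by
  have hγ := poisson_dotProduct_self hq.orthogonal.2
  have hL : lagrangian S q (horLift S q w) = 1 / 2 * velDeriv S q (horLift S q w) (horLift S q w)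
      - S.m * S.g * S.ℓ * poisson q (Fin.last d) := by
    rw [lagrangian_eq, velDeriv_eq]; ring
  rw [energy, hL, velDeriv_horLift hq hw hw, redHam]
  dsimp only
  generalize poisson q = γ at *
  have hA := (multiplier_pos hS hγ).ne'
  have hB := (tiltInertia_pos hS hγ).ne'
  have hp := dotProduct_legendre (S := S) hγ hw
  -- Pairing `p = A w + C w_n (e_n - γ_n γ)` with `p`, where `p · γ = 0`, expresses twice the
  -- kinetic energy `p · w` through `|p|²` and `p_n`.
  have key : legendre S γ w ⬝ᵥ legendre S γ w = multiplier S γ * (legendre S γ w ⬝ᵥ w) +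
      axisInertia S * w (Fin.last d) * legendre S γ w (Fin.last d) := by
    conv_lhs => arg 2; rw [legendre]
    rw [dotProduct_add, dotProduct_smul, dotProduct_smul, dotProduct_sub, dotProduct_smul,
      dotProduct_eLast, dotProduct_comm _ γ, hp]
    simp
  rw [key, legendre_last]
  field_simp
  ring

end

/-! ### The momentum equation along the constraint distribution -/

section

open Matrix Filter Topology
variable {S : Params}

/-- The bracket of two horizontal rotations is vertical: it fixes `γ`. It accounts for the
difference between the two orders in which the lifts of `w` and `η` are multiplied below. -/
lemma wedge_commutator {γ w η : Vec d} (hγ : γ ⬝ᵥ γ = 1) (hw : γ ⬝ᵥ w = 0) (hη : γ ⬝ᵥ η = 0) :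
    wedge γ w * wedge γ η - wedge γ η * wedge γ w = wedge η w := by
  have hw' : w ⬝ᵥ γ = 0 := by rw [dotProduct_comm, hw]
  have hη' : η ⬝ᵥ γ = 0 := by rw [dotProduct_comm, hη]
  simp only [wedge, mul_sub, sub_mul, vecMulVec_mul_vecMulVec, hγ, hw, hη, hw', hη', zero_smul,
    vecMulVec_smul, one_smul, dotProduct_comm η w]
  simp only [vecMulVec_zero]
  abel

lemma hasDerivAt_poisson {q : ℝ → Amb d} {w : Vec d} {t : ℝ} (h : (q t).1 * (q t).1ᵀ = 1)
    (hw : poisson (q t) ⬝ᵥ w = 0)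
    (hR : HasDerivAt (fun s => (q s).1) ((q t).1 * wedge (poisson (q t)) w) t) :
    HasDerivAt (fun s => poisson (q s)) w t := by
  have := hR.matrix_transpose.matrix_mulVec (hasDerivAt_const t (eLast d))
  refine this.congr_deriv ?_
  rw [mulVec_zero, add_zero]
  -- The parameters are arbitrary here: they affect only the translational part of the lift, which
  -- `poissonVel` does not see.
  exact poissonVel_horLift (S := ⟨0, 0, 0, 0, 0, 0⟩) h hw

lemma _root_.HasDerivAt.vec_apply {v : ℝ → Vec d} {v' : Vec d} {t : ℝ} (h : HasDerivAt v v' t)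
    (i : Fin (d + 1)) : HasDerivAt (fun s => v s i) (v' i) t :=
  hasDerivAt_pi.mp h i

lemma hasDerivAt_multiplier (S : Params) {γ : ℝ → Vec d} {γ' : Vec d} {t : ℝ}
    (h : HasDerivAt γ γ' t) :
    HasDerivAt (fun s => multiplier S (γ s))
      (2 * (axisInertia S * γ t (Fin.last d) + S.m * S.b * S.ℓ) * γ' (Fin.last d)) t := by
  have hn := h.vec_apply (Fin.last d)
  refine (((hn.fun_pow 2).const_mul (S.Jₙ - S.J₁)).const_add (2 * S.J₁) |>.fun_add
    ((((hn.const_mul S.ℓ).const_add S.b).fun_pow 2).const_mul S.m)).congr_deriv ?_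
  simp only [axisInertia]
  push_cast
  ring

/-- The derivative of `legendre` at `(γ, w)` along `(γ', w')`. -/
def legendreDeriv (S : Params) (γ w γ' w' : Vec d) : Vec d :=
  (2 * (axisInertia S * γ (Fin.last d) + S.m * S.b * S.ℓ) * γ' (Fin.last d)) • w +
    multiplier S γ • w' +
    (axisInertia S * w' (Fin.last d)) • (eLast d - γ (Fin.last d) • γ) -
    (axisInertia S * w (Fin.last d)) • (γ' (Fin.last d) • γ + γ (Fin.last d) • γ')

lemma hasDerivAt_legendre (S : Params) {γ w : ℝ → Vec d} {γ' w' : Vec d} {t : ℝ}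
    (hγ : HasDerivAt γ γ' t) (hw : HasDerivAt w w' t) :
    HasDerivAt (fun s => legendre S (γ s) (w s)) (legendreDeriv S (γ t) (w t) γ' w') t := by
  have hn := hγ.vec_apply (Fin.last d)
  refine (((hasDerivAt_multiplier S hγ).fun_smul hw).fun_add
    (((hw.vec_apply (Fin.last d)).const_mul (axisInertia S)).fun_smul
      ((hn.fun_smul hγ).const_sub (eLast d)))).congr_deriv ?_
  rw [legendreDeriv]
  module

/-- The left-hand side of the Lagrange–d'Alembert equations along `D`. -/
lemma hasDerivAt_velDeriv {q : ℝ → Amb d} {w : ℝ → Vec d} {w' η : Vec d} {t : ℝ}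
    (hq : ∀ᶠ s in 𝓝 t, IsConfig S (q s) ∧ velocity q s = horLift S (q s) (w s) ∧
      poisson (q s) ⬝ᵥ w s = 0)
    (hR : HasDerivAt (fun s => (q s).1) ((q t).1 * wedge (poisson (q t)) (w t)) t)
    (hw : HasDerivAt w w' t) (hη : poisson (q t) ⬝ᵥ η = 0) :
    HasDerivAt (fun s => velDeriv S (q s) (velocity q s) (horLift S (q t) η))
      (posDeriv S (q t) (velocity q t) (horLift S (q t) η) +
        ((legendreDeriv S (poisson (q t)) (w t) (w t) w' ⬝ᵥ η)
          - S.m * S.b * S.ℓ * w t (Fin.last d) * (w t ⬝ᵥ η)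
          + S.m * S.g * S.ℓ * η (Fin.last d))) t := by
  obtain ⟨hqt, hvt, hwt⟩ := hq.self_of_nhds
  obtain ⟨h', h⟩ := hqt.orthogonal
  have hγ1 := poisson_dotProduct_self h
  have hγ := hasDerivAt_poisson h hwt hR
  -- The normal part of the acceleration, from differentiating `γ · w = 0`.
  have hww : poisson (q t) ⬝ᵥ w' = -(w t ⬝ᵥ w t) := by
    have h1 := hγ.dotProduct hw
    have h2 : (fun s => poisson (q s) ⬝ᵥ w s) =ᶠ[𝓝 t] fun _ => (0 : ℝ) :=
      hq.mono fun s hs => hs.2.2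
    have := h1.unique ((hasDerivAt_const t (0 : ℝ)).congr_of_eventuallyEq h2)
    linarith
  have hcongr : (fun s => velDeriv S (q s) (velocity q s) (horLift S (q t) η)) =ᶠ[𝓝 t] fun s =>
      killing (inertia S (wedge (poisson (q s)) (w s))) ((q s).1ᵀ * (horLift S (q t) η).1) +
        S.m * ((-(S.b • w s) + S.ℓ •
            (w s (Fin.last d) • poisson (q s) - poisson (q s) (Fin.last d) • w s)) ⬝ᵥ
          ((q s).1ᵀ *ᵥ (horLift S (q t) η).2 +
            S.ℓ • (((q s).1ᵀ * (horLift S (q t) η).1) *ᵥ eLast d))) := by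
    filter_upwards [hq] with s hs
    rw [velDeriv_eq, hs.2.1, transpose_mul_horLift hs.1.orthogonal.1,
      bodyVel_horLift hs.1.orthogonal.1]
    rfl
  refine HasDerivAt.congr_of_eventuallyEq ?_ hcongr
  have e1 : ((q t).1 * wedge (poisson (q t)) (w t))ᵀ * (horLift S (q t) η).1 =
      -(wedge (poisson (q t)) (w t) * wedge (poisson (q t)) η) := by
    rw [transpose_mul, wedge_transpose, mul_assoc, transpose_mul_horLift h', neg_mul]
  have hX : HasDerivAt (fun s => (q s).1ᵀ * (horLift S (q t) η).1)
      (-(wedge (poisson (q t)) (w t) * wedge (poisson (q t)) η)) t := by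
    have h0 : HasDerivAt (fun _ : ℝ => (horLift S (q t) η).1) 0 t :=
      hasDerivAt_matrix.mpr fun i j => hasDerivAt_const t _
    convert hR.matrix_transpose.matrix_mul h0 using 1
    rw [e1, mul_zero, add_zero]
  have hY := (hw.const_smul S.b).fun_neg.fun_add
    ((((hw.vec_apply (Fin.last d)).fun_smul hγ).fun_sub
      ((hγ.vec_apply (Fin.last d)).fun_smul hw)).const_smul S.ℓ)
  have hZ := (hR.matrix_transpose.matrix_mulVec (hasDerivAt_const t (horLift S (q t) η).2)).fun_add
    ((hX.matrix_mulVec (hasDerivAt_const t (eLast d))).const_smul S.ℓ)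
  have hmain := ((hγ.wedge hw).killing_inertia S hX).fun_add ((hY.dotProduct hZ).const_mul S.m)
  refine hmain.congr_deriv ?_
  have e2 : (horLift S (q t) η).1ᵀ * (horLift S (q t) (w t)).1 =
      -(wedge (poisson (q t)) η * wedge (poisson (q t)) (w t)) := by
    simp only [horLift]
    rw [transpose_mul, wedge_transpose, mul_assoc, ← mul_assoc (q t).1ᵀ, h', one_mul, neg_mul]
  have e3 : (q t).1ᵀ *ᵥ (horLift S (q t) η).2 = -(S.b • η) := by
    simp [horLift, mulVec_neg, mulVec_smul, mulVec_mulVec, h']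
  have e4 : ((q t).1 * wedge (poisson (q t)) (w t))ᵀ *ᵥ (horLift S (q t) η).2 =
      (S.b * (w t ⬝ᵥ η)) • poisson (q t) := by
    rw [transpose_mul, wedge_transpose, ← mulVec_mulVec, e3, neg_mulVec, mulVec_neg, neg_neg,
      mulVec_smul, wedge_mulVec, hη, zero_smul, sub_zero, smul_smul]
  have e5 : (horLift S (q t) η).1ᵀ *ᵥ (horLift S (q t) (w t)).2 =
      (S.b * (w t ⬝ᵥ η)) • poisson (q t) := by
    simp only [horLift]
    rw [transpose_mul, wedge_transpose, ← mulVec_mulVec, mulVec_neg, mulVec_smul, mulVec_mulVec,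
      h', one_mulVec, mulVec_neg, neg_mulVec, neg_neg, mulVec_smul, wedge_mulVec, hwt, zero_smul,
      sub_zero, smul_smul, dotProduct_comm]
  have e6 : poisson (horLift S (q t) η) = η := poissonVel_horLift h hη
  -- Differentiating the transposed `R` yields one order of the product, and `posDeriv` yields the
  -- other. After this exchange the common product `P` cancels as an opaque matrix, and only `η ∧ w`
  -- has to be evaluated.
  have e7 : wedge (poisson (q t)) (w t) * wedge (poisson (q t)) η =
      wedge (poisson (q t)) η * wedge (poisson (q t)) (w t) + wedge η (w t) := by
    rw [← wedge_commutator hγ1 hwt hη]; abel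
  have e8 : wedge (w t) (w t) = 0 := by simp [wedge]
  rw [posDeriv_eq, hvt, bodyVel_horLift h', bodyVel, transpose_mul_horLift h',
    transpose_mul_horLift h', e2, e3, e4, e5, e6, e8, zero_add]
  simp only [Pi.smul_apply, transpose_mul_horLift h', mulVec_zero, add_zero, e7]
  generalize wedge (poisson (q t)) η * wedge (poisson (q t)) (w t) = P
  generalize poisson (q t) = γ at *
  generalize w t = u at *
  have hsplit : -(P + wedge η u) = -P + (-1 : ℝ) • wedge η u := by
    rw [neg_add, neg_one_smul]
  rw [hsplit, killing_inertia_add_right, killing_inertia_smul_right, add_mulVec, smul_mulVec,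
    wedge_mulVec, wedge_mulVec, killing_inertia_wedge, killing_inertia_wedge]
  have hu : u ⬝ᵥ γ = 0 := by rw [dotProduct_comm, hwt]
  simp only [massTensor_mulVec_dotProduct, legendreDeriv, multiplier, axisInertia, add_dotProduct,
    neg_dotProduct, smul_dotProduct, sub_dotProduct, dotProduct_add, dotProduct_neg,
    dotProduct_smul, dotProduct_sub, smul_eq_mul, hγ1, hη, hu, hwt, eLast_dotProduct,
    dotProduct_eLast, dotProduct_comm w' γ, hww]
  ring

end

/-! ### Motions project to the reduced vector field -/

section

open Matrix Filter Topology
variable {S : Params}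

lemma eq_zero_of_forall_dotProduct {γ D : Vec d} (hD : γ ⬝ᵥ D = 0)
    (h : ∀ η : Vec d, γ ⬝ᵥ η = 0 → D ⬝ᵥ η = 0) : D = 0 :=
  dotProduct_self_eq_zero.mp (h D hD)

/-- The pairing with lifts determines `p` against vectors orthogonal to `γ`, and `p ⟂ γ` is part of
the state; hence `p` is unique. -/
lemma IsReducedState.eq_legendre {q v : Amb d} {z : Phase d} (h : IsReducedState S q v z)
    (hq : IsConfig S q) (hv : Dist S q v) :
    z = (poisson q, legendre S (poisson q) (poissonVel v)) := by
  obtain ⟨hz, h1, h2⟩ := h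
  obtain ⟨hv1, hv2⟩ := hv.eq_horLift hq
  have hγ := poisson_dotProduct_self hq.orthogonal.2
  refine Prod.ext h1 (sub_eq_zero.mp (eq_zero_of_forall_dotProduct (γ := poisson q) ?_ ?_))
  · rw [dotProduct_sub, dotProduct_legendre hγ hv2, ← h1, hz.2, sub_zero]
  · intro η hη
    have := h2 _ (dist_horLift hq hη)
    rw [poissonVel_horLift hq.orthogonal.2 hη] at this
    rw [sub_dotProduct, this, hv1, velDeriv_horLift hq hv2 hη, poissonVel_horLift
      hq.orthogonal.2 hv2, sub_self]

lemma isReducedHamiltonian_redHam (hS : S.Pos) : IsReducedHamiltonian S (redHam (d := d) S) := by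
  intro q v z hq hv hz
  obtain ⟨hv1, hv2⟩ := hv.eq_horLift hq
  rw [hz.eq_legendre hq hv, hv1, energy_horLift hS hq hv2, poissonVel_horLift hq.orthogonal.2 hv2]

lemma redField_projects (hS : S.Pos) (q : ℝ → Amb d) (z : ℝ → Phase d) (t₀ t₁ : ℝ)
    (hq : IsMotion S q t₀ t₁)
    (hz : ∀ t ∈ Ioo t₀ t₁, IsReducedState S (q t) (velocity q t) (z t)) (t : ℝ)
    (ht : t ∈ Ioo t₀ t₁) : HasDerivAt z (redField S (z t)) t := by
  set w : ℝ → Vec d := fun s => poissonVel (velocity q s) with hw_def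
  have hev : ∀ᶠ s in 𝓝 t, s ∈ Ioo t₀ t₁ := isOpen_Ioo.mem_nhds ht
  have hcons : ∀ s ∈ Ioo t₀ t₁, IsConfig S (q s) ∧ velocity q s = horLift S (q s) (w s) ∧
      poisson (q s) ⬝ᵥ w s = 0 := fun s hs =>
    ⟨hq.config s hs, (hq.constraint s hs).eq_horLift (hq.config s hs)⟩
  have hzs : ∀ s ∈ Ioo t₀ t₁, z s = (poisson (q s), legendre S (poisson (q s)) (w s)) :=
    fun s hs => (hz s hs).eq_legendre (hq.config s hs) (hq.constraint s hs)
  obtain ⟨hqt, hvt, hwt⟩ := hcons t ht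
  have hR : HasDerivAt (fun s => (q s).1) ((q t).1 * wedge (poisson (q t)) (w t)) t := by
    have : (q t).1 * wedge (poisson (q t)) (w t) = (velocity q t).1 := by rw [hvt]; rfl
    rw [this, hasDerivAt_matrix]
    exact fun i j => (((hq.contDiff_rot i j).differentiableOn (by norm_num)).differentiableAt
      (isOpen_Ioo.mem_nhds ht)).hasDerivAt
  obtain ⟨w', hw⟩ : ∃ w', HasDerivAt w w' t := by
    have hV : ∀ i j, DifferentiableAt ℝ (fun s => (velocity q s).1 i j) t := fun i j =>
      (((contDiffOn_succ_iff_deriv_of_isOpen (n := 1) isOpen_Ioo).mp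
        (hq.contDiff_rot i j)).2.2.differentiableOn (by norm_num)).differentiableAt
        (isOpen_Ioo.mem_nhds ht)
    have : HasDerivAt (fun s => (velocity q s).1) (of fun i j =>
        deriv (fun s => (velocity q s).1 i j) t) t :=
      hasDerivAt_matrix.mpr fun i j => (hV i j).hasDerivAt
    exact ⟨_, this.matrix_transpose.matrix_mulVec (hasDerivAt_const t (eLast d))⟩
  have hγ1 := poisson_dotProduct_self hqt.orthogonal.2
  have hγ := hasDerivAt_poisson hqt.orthogonal.2 hwt hR
  have hp := hasDerivAt_legendre S hγ hw
  have hp0 : poisson (q t) ⬝ᵥ legendre S (poisson (q t)) (w t) = 0 := dotProduct_legendre hγ1 hwt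
  have hpγ := (hγ.dotProduct hp).unique ((hasDerivAt_const t (0 : ℝ)).congr_of_eventuallyEq
    (hev.mono fun s hs => dotProduct_legendre
      (poisson_dotProduct_self (hcons s hs).1.orthogonal.2) (hcons s hs).2.2))
  have hforce : legendreDeriv S (poisson (q t)) (w t) (w t) w' =
      force S (poisson (q t)) (legendre S (poisson (q t)) (w t)) (w t) := by
    -- Along `γ` both sides have scalar product `-(p · w)`, because `γ · p` vanishes identically.
    -- Against `η ⟂ γ` they agree by the d'Alembert principle for the lift of `η`.
    refine sub_eq_zero.mp (eq_zero_of_forall_dotProduct (γ := poisson (q t)) ?_ fun η hη => ?_)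
    · rw [dotProduct_sub, dotProduct_force hγ1 hwt]
      linarith
    · have h1 := (hasDerivAt_velDeriv (hev.mono hcons) hR hw hη).unique
        (hq.dAlembert t ht _ (dist_horLift hqt hη))
      rw [sub_dotProduct]
      simp only [force, sub_dotProduct, smul_dotProduct, smul_eq_mul, eLast_dotProduct, hη]
      linarith
  rw [hforce] at hp
  refine ((hγ.prodMk hp).congr_of_eventuallyEq (hev.mono hzs)).congr_deriv ?_
  rw [hzs t ht, redField, shapeVel_legendre hS hγ1]

/-! ### Smoothness -/

section smooth
variable {E : Type*} [NormedAddCommGroup E] [NormedSpace ℝ E] {n : WithTop ℕ∞} {x : E}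
  {u v : E → Vec d}

lemma _root_.ContDiffAt.vec_apply (hu : ContDiffAt ℝ n u x) (i : Fin (d + 1)) :
    ContDiffAt ℝ n (fun y => u y i) x :=
  contDiffAt_pi.mp hu i

lemma _root_.ContDiffAt.dotProduct (hu : ContDiffAt ℝ n u x) (hv : ContDiffAt ℝ n v x) :
    ContDiffAt ℝ n (fun y => u y ⬝ᵥ v y) x := by
  simp only [_root_.dotProduct]
  exact ContDiffAt.sum fun i _ => (hu.vec_apply i).mul (hv.vec_apply i)

lemma _root_.ContDiffAt.multiplier (S : Params) (hu : ContDiffAt ℝ n u x) :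
    ContDiffAt ℝ n (fun y => multiplier S (u y)) x := by
  have := hu.vec_apply (Fin.last d)
  unfold RubberRouth.multiplier
  fun_prop

lemma _root_.ContDiffAt.shapeVel (hu : ContDiffAt ℝ n u x) (hv : ContDiffAt ℝ n v x)
    (hA : multiplier S (u x) ≠ 0) (hB : tiltInertia S (u x) ≠ 0) :
    ContDiffAt ℝ n (fun y => shapeVel S (u y) (v y)) x := by
  have h1 := hu.vec_apply (Fin.last d)
  have h2 := hv.vec_apply (Fin.last d)
  have h3 : ContDiffAt ℝ n (fun y => tiltInertia S (u y)) x := by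
    unfold tiltInertia
    fun_prop
  exact ((hu.multiplier S).inv hA).smul (hv.sub (((contDiffAt_const.mul h2).div h3 hB).smul
    (contDiffAt_const.sub (h1.smul hu))))

lemma _root_.ContDiffAt.force {w : E → Vec d} (hu : ContDiffAt ℝ n u x) (hv : ContDiffAt ℝ n v x)
    (hw : ContDiffAt ℝ n w x) : ContDiffAt ℝ n (fun y => force S (u y) (v y) (w y)) x := by
  have h1 := hu.vec_apply (Fin.last d)
  have h2 := hw.vec_apply (Fin.last d)
  exact (((contDiffAt_const.mul h2).smul hw).sub ((contDiffAt_const (c := S.m * S.g * S.ℓ)).smul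
    (contDiffAt_const.sub (h1.smul hu)))).sub ((hv.dotProduct hw).smul hu)

lemma _root_.ContDiffAt.matrix_mulVec {M : E → Fin (d + 1) → Fin (d + 1) → ℝ}
    (hM : ContDiffAt ℝ n M x) (hv : ContDiffAt ℝ n v x) :
    ContDiffAt ℝ n (fun y => of (M y) *ᵥ v y) x :=
  contDiffAt_pi.mpr fun i => (contDiffAt_pi.mp hM i).dotProduct hv

end smooth

lemma redField_smooth (hS : S.Pos) : ∃ U : Set (Phase d), IsOpen U ∧ cotangentSphere d ⊆ U ∧
    ContDiffOn ℝ ∞ (redField S) U := by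
  refine ⟨{z | multiplier S z.1 ≠ 0} ∩ {z | tiltInertia S z.1 ≠ 0}, ?_, fun z hz =>
    ⟨(multiplier_pos hS hz.1).ne', (tiltInertia_pos hS hz.1).ne'⟩, fun z hz => ?_⟩
  · refine (isOpen_ne_fun ?_ continuous_const).inter (isOpen_ne_fun ?_ continuous_const)
    · unfold multiplier; fun_prop
    · unfold tiltInertia; fun_prop
  · have h := (contDiffAt_fst (𝕜 := ℝ) (n := ∞) (p := z)).shapeVel (S := S) contDiffAt_snd hz.1 hz.2
    exact (h.prodMk (contDiffAt_fst.force contDiffAt_snd h)).contDiffWithinAt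

end

/-! ### Existence of motions -/

section

open Matrix Filter Topology
variable {S : Params}

lemma eq_of_hasDerivAt_zero {f : ℝ → ℝ} {a b : ℝ} (hf : ∀ t ∈ Ioo a b, HasDerivAt f 0 t)
    {s t : ℝ} (hs : s ∈ Ioo a b) (ht : t ∈ Ioo a b) : f s = f t :=
  isOpen_Ioo.is_const_of_deriv_eq_zero isPreconnected_Ioo
    (fun x hx => (hf x hx).differentiableAt.differentiableWithinAt) (fun x hx => (hf x hx).deriv)
    hs ht

/-- Bootstrap: if the curve is `C^n`, so is its derivative `f ∘ α`, for `n = 0` and then `n = 1`. It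
supplies the `C²` regularity required of motions. -/
lemma contDiffOn_two_of_integralCurve {E : Type*} [NormedAddCommGroup E] [NormedSpace ℝ E]
    {f : E → E} {α : ℝ → E} {s : Set ℝ} (hs : IsOpen s)
    (hα : ∀ t ∈ s, HasDerivAt α (f (α t)) t) (hf : ∀ t ∈ s, ContDiffAt ℝ 1 f (α t)) :
    ContDiffOn ℝ 2 α s := by
  have hd : DifferentiableOn ℝ α s := fun t ht =>
    (hα t ht).differentiableAt.differentiableWithinAt
  have step : ∀ n : WithTop ℕ∞, n ≤ 1 → n ≠ ω → ContDiffOn ℝ n α s → ContDiffOn ℝ (n + 1) α s := by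
    intro n hn hn' h
    refine (contDiffOn_succ_iff_deriv_of_isOpen hs).mpr ⟨hd, fun h => (hn' h).elim, ?_⟩
    have : ContDiffOn ℝ n (f ∘ α) s := fun t ht =>
      ((hf t ht).of_le hn).comp_contDiffWithinAt t (h t ht)
    exact this.congr fun t ht => (hα t ht).deriv
  have h1 := step 0 (by norm_num) (by simp) (contDiffOn_zero.mpr hd.continuousOn)
  have h2 := step 1 le_rfl (by simp) (by simpa using h1)
  rwa [show (1 : WithTop ℕ∞) + 1 = 2 by norm_num] at h2

/-- The space of triples `(R, x, p)`, normed as a product. -/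
abbrev Lifted (d : ℕ) := (Fin (d + 1) → Fin (d + 1) → ℝ) × Vec d × Vec d

/-- The configuration of a triple `(R, x, p)`. -/
def Lifted.config (y : Lifted d) : Amb d := (of y.1, y.2.1)

/-- The shape velocity of a triple `(R, x, p)`; it is tangent to the sphere even if `p` is not. -/
def Lifted.vel (S : Params) (y : Lifted d) : Vec d :=
  shapeVel S (poisson y.config) (y.2.2 - (poisson y.config ⬝ᵥ y.2.2) • poisson y.config)

/-- The equations of motion for triples `(R, x, p)`. -/
def liftedField (S : Params) (y : Lifted d) : Lifted d :=
  (fun i j => (horLift S y.config (y.vel S)).1 i j, (horLift S y.config (y.vel S)).2,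
    force S (poisson y.config) y.2.2 (y.vel S))

lemma contDiffAt_liftedField {y : Lifted d} (hA : multiplier S (poisson y.config) ≠ 0)
    (hB : tiltInertia S (poisson y.config) ≠ 0) : ContDiffAt ℝ 1 (liftedField S) y := by
  have hR : ContDiffAt ℝ 1 (fun y : Lifted d => y.1) y := contDiffAt_fst
  have hp : ContDiffAt ℝ 1 (fun y : Lifted d => y.2.2) y := contDiffAt_snd.snd
  have hRe : ∀ i j, ContDiffAt ℝ 1 (fun y : Lifted d => y.1 i j) y := fun i j =>
    contDiffAt_pi.mp (contDiffAt_pi.mp hR i) j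
  have hγ : ContDiffAt ℝ 1 (fun y : Lifted d => poisson y.config) y := by
    have hT : ContDiffAt ℝ 1 (fun (y : Lifted d) i j => y.1 j i) y :=
      contDiffAt_pi.mpr fun i => contDiffAt_pi.mpr fun j => hRe j i
    exact hT.matrix_mulVec contDiffAt_const
  have hw : ContDiffAt ℝ 1 (fun y : Lifted d => y.vel S) y :=
    hγ.shapeVel (hp.sub ((hγ.dotProduct hp).smul hγ)) hA hB
  refine ContDiffAt.prodMk (contDiffAt_pi.mpr fun i => contDiffAt_pi.mpr fun j => ?_)
    (ContDiffAt.prodMk ?_ (hγ.force hp hw))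
  · simp only [horLift, Lifted.config, mul_apply, of_apply, wedge, Matrix.sub_apply,
      vecMulVec_apply]
    exact ContDiffAt.sum fun k _ => (hRe i k).mul
      (((hγ.vec_apply k).mul (hw.vec_apply j)).sub ((hw.vec_apply k).mul (hγ.vec_apply j)))
  · exact ((contDiffAt_const (c := S.b)).smul (hR.matrix_mulVec hw)).neg

/-- Picard–Lindelöf is applied to `(R, x, p)` in a full vector space. The constraints are then
recovered as conserved quantities: `R Rᵀ`, `γ · p`, `x_n`, and `det R` by continuity. -/
lemma exists_motion (hS : S.Pos) (q₀ v₀ : Amb d) (hq₀ : IsConfig S q₀) (hv₀ : Dist S q₀ v₀) :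
    ∃ ε > 0, ∃ q : ℝ → Amb d, IsMotion S q (-ε) ε ∧ q 0 = q₀ ∧ velocity q 0 = v₀ := by
  obtain ⟨hv1, hw0⟩ := hv₀.eq_horLift hq₀
  set w₀ := poissonVel v₀
  have hγ0 := poisson_dotProduct_self hq₀.orthogonal.2
  set y₀ : Lifted d := (fun i j => q₀.1 i j, q₀.2, legendre S (poisson q₀) w₀) with hy₀
  have hc0 : y₀.config = q₀ := rfl
  obtain ⟨α, hα0, ε, hε, hα⟩ :=
    (contDiffAt_liftedField (S := S) (y := y₀) (multiplier_pos hS hγ0).ne'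
      (tiltInertia_pos hS hγ0).ne').exists_forall_mem_closedBall_exists_eq_forall_mem_Ioo_hasDerivAt₀
      (0 : ℝ)
  rw [zero_sub, zero_add] at hα
  have h0 : (0 : ℝ) ∈ Ioo (-ε) ε := ⟨by linarith, hε⟩
  set q : ℝ → Amb d := fun t => (α t).config with hq_def
  set w : ℝ → Vec d := fun t => (α t).vel S with hw_def
  set p : ℝ → Vec d := fun t => (α t).2.2 with hp_def
  have hq0 : q 0 = q₀ := by simp only [hq_def, hα0, hc0]
  have hp0 : p 0 = legendre S (poisson q₀) w₀ := by simp only [hp_def, hα0, hy₀]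
  have hR : ∀ t ∈ Ioo (-ε) ε, HasDerivAt (fun s => (q s).1)
      ((q t).1 * wedge (poisson (q t)) (w t)) t := fun t ht =>
    hasDerivAt_matrix.mpr fun i j => hasDerivAt_pi.mp (hasDerivAt_pi.mp (hα t ht).fst i) j
  have hx : ∀ t ∈ Ioo (-ε) ε, HasDerivAt (fun s => (q s).2) (-(S.b • ((q t).1 *ᵥ w t))) t :=
    fun t ht => (hα t ht).snd.fst
  have hp : ∀ t ∈ Ioo (-ε) ε, HasDerivAt p (force S (poisson (q t)) (p t) (w t)) t :=
    fun t ht => (hα t ht).snd.snd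
  have horth : ∀ t ∈ Ioo (-ε) ε, (q t).1 * (q t).1ᵀ = 1 := by
    intro t ht
    have hd : ∀ t ∈ Ioo (-ε) ε, HasDerivAt (fun s => (q s).1 * (q s).1ᵀ) 0 t := by
      intro t ht
      convert (hR t ht).matrix_mul (hR t ht).matrix_transpose using 1
      rw [transpose_mul, wedge_transpose, neg_mul, mul_neg, mul_assoc, add_neg_cancel]
    ext i j
    rw [eq_of_hasDerivAt_zero (fun t ht => hasDerivAt_matrix.mp (hd t ht) i j) ht h0, hq0,
      hq₀.orthogonal.2]
  have hγ1 := fun t ht => poisson_dotProduct_self (horth t ht)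
  -- The projection of `p` built into `Lifted.vel` avoids a circle: `γ · w = 0` must be known before
  -- `γ · p = 0`, whose proof uses `γ̇ = w`.
  have hwγ : ∀ t ∈ Ioo (-ε) ε, poisson (q t) ⬝ᵥ w t = 0 := fun t ht =>
    dotProduct_shapeVel (hγ1 t ht) (by
      change poisson (q t) ⬝ᵥ (p t - (poisson (q t) ⬝ᵥ p t) • poisson (q t)) = 0
      rw [dotProduct_sub, dotProduct_smul, hγ1 t ht]; simp)
  have hγ : ∀ t ∈ Ioo (-ε) ε, HasDerivAt (fun s => poisson (q s)) (w t) t := fun t ht =>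
    hasDerivAt_poisson (horth t ht) (hwγ t ht) (hR t ht)
  have hpγ : ∀ t ∈ Ioo (-ε) ε, poisson (q t) ⬝ᵥ p t = 0 := by
    intro t ht
    have hd : ∀ t ∈ Ioo (-ε) ε, HasDerivAt (fun s => poisson (q s) ⬝ᵥ p s) 0 t := fun t ht =>
      ((hγ t ht).dotProduct (hp t ht)).congr_deriv (by
        rw [dotProduct_force (hγ1 t ht) (hwγ t ht), add_neg_cancel])
    rw [eq_of_hasDerivAt_zero hd ht h0, hq0, hp0, dotProduct_legendre hγ0 hw0]
  have hw : ∀ t ∈ Ioo (-ε) ε, w t = shapeVel S (poisson (q t)) (p t) := fun t ht => by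
    change shapeVel S (poisson (q t)) (p t - (poisson (q t) ⬝ᵥ p t) • poisson (q t)) = _
    rw [hpγ t ht, zero_smul, sub_zero]
  have hdet : ∀ t ∈ Ioo (-ε) ε, (q t).1.det = 1 := by
    have hcont : ContinuousOn (fun t => (q t).1.det) (Ioo (-ε) ε) := fun t ht => by
      have : ContinuousAt (fun s => (q s).1) t :=
        continuousAt_pi.mpr fun i => continuousAt_pi.mpr fun j =>
          (hasDerivAt_matrix.mp (hR t ht) i j).continuousAt
      have hdet : Continuous fun A : Mat d => A.det := continuous_id.matrix_det
      exact (hdet.continuousAt.comp (f := fun s => (q s).1) this).continuousWithinAt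
    have hsq : EqOn ((fun t => (q t).1.det) ^ 2) 1 (Ioo (-ε) ε) := fun t ht => by
      have := congrArg det (horth t ht)
      rw [det_mul, det_transpose, det_one] at this
      simpa [sq] using this
    have h1 : (q 0).1.det = 1 := by
      rw [hq0]; exact (mem_specialOrthogonalGroup_iff.mp hq₀.1).2
    rcases isPreconnected_Ioo.eq_one_or_eq_neg_one_of_sq_eq hcont hsq with h | h
    · exact h
    · have := h h0
      simp only [h1, Pi.neg_apply, Pi.one_apply] at this
      norm_num at this
  have hconf : ∀ t ∈ Ioo (-ε) ε, IsConfig S (q t) := by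
    intro t ht
    refine ⟨mem_specialOrthogonalGroup_iff.mpr
      ⟨(mem_orthogonalGroup_iff _ _).mpr (horth t ht), hdet t ht⟩, ?_⟩
    have hd : ∀ t ∈ Ioo (-ε) ε, HasDerivAt (fun s => (q s).2 (Fin.last d)) 0 t := fun t ht =>
      ((hx t ht).vec_apply (Fin.last d)).congr_deriv (by
        have : ((q t).1 *ᵥ w t) (Fin.last d) = 0 := by
          rw [← eLast_dotProduct ((q t).1 *ᵥ w t), dotProduct_mulVec, ← mulVec_transpose]
          exact hwγ t ht
        simp [this])
    rw [eq_of_hasDerivAt_zero hd ht h0, hq0, hq₀.2]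
  have hvel : ∀ t ∈ Ioo (-ε) ε, velocity q t = horLift S (q t) (w t) := fun t ht =>
    Prod.ext (by ext i j; exact (hasDerivAt_matrix.mp (hR t ht) i j).deriv)
      (by ext i; exact ((hx t ht).vec_apply i).deriv)
  have hC2 : ContDiffOn ℝ 2 α (Ioo (-ε) ε) :=
    contDiffOn_two_of_integralCurve isOpen_Ioo hα fun t ht =>
      contDiffAt_liftedField (multiplier_pos hS (hγ1 t ht)).ne' (tiltInertia_pos hS (hγ1 t ht)).ne'
  refine ⟨ε, hε, q, ⟨fun i j => ?_, fun i => ?_, hconf, fun t ht => ?_, fun t ht δ hδ => ?_⟩, hq0,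
    ?_⟩
  · exact contDiffOn_pi.mp (contDiffOn_pi.mp hC2.fst i) j
  · exact contDiffOn_pi.mp hC2.snd.fst i
  · rw [hvel t ht]
    exact dist_horLift (hconf t ht) (hwγ t ht)
  · have hev : ∀ᶠ s in 𝓝 t, s ∈ Ioo (-ε) ε := isOpen_Ioo.mem_nhds ht
    obtain ⟨hδ1, hδ2⟩ := hδ.eq_horLift (hconf t ht)
    obtain ⟨w', hw'⟩ : ∃ w', HasDerivAt w w' t := by
      have hc : ContDiffAt ℝ 1 (fun z : Phase d => shapeVel S z.1 z.2) (poisson (q t), p t) :=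
        contDiffAt_fst.shapeVel contDiffAt_snd (multiplier_pos hS (hγ1 t ht)).ne'
          (tiltInertia_pos hS (hγ1 t ht)).ne'
      have hcomp := HasFDerivAt.comp_hasDerivAt (f := fun s => (poisson (q s), p s)) t
        (hc.differentiableAt one_ne_zero).hasFDerivAt ((hγ t ht).prodMk (hp t ht))
      exact ⟨_, hcomp.congr_of_eventuallyEq (hev.mono hw)⟩
    have hpl : ∀ s ∈ Ioo (-ε) ε, legendre S (poisson (q s)) (w s) = p s := fun s hs => by
      rw [hw s hs, legendre_shapeVel hS (hγ1 s hs)]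
    -- Both sides are the derivative of `p`, computed as a Legendre image and from the ODE. With
    -- this equality the extra bracket in `hasDerivAt_velDeriv` vanishes, which is the d'Alembert
    -- principle.
    have heq := (hasDerivAt_legendre S (hγ t ht) hw').unique
      ((hp t ht).congr_of_eventuallyEq (hev.mono hpl))
    have key := hasDerivAt_velDeriv (hev.mono fun s hs => ⟨hconf s hs, hvel s hs, hwγ s hs⟩)
      (hR t ht) hw' hδ2
    rw [← hδ1, heq] at key
    refine key.congr_deriv ?_
    simp only [force, sub_dotProduct, smul_dotProduct, smul_eq_mul, eLast_dotProduct, hδ2]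
    ring
  · rw [hvel 0 h0, hw 0 h0, hq0, hp0, shapeVel_legendre hS hγ0, ← hv1]

lemma isReducedVectorField_redField (hS : S.Pos) :
    IsReducedVectorField (d := d) S (redField S) :=
  ⟨redField_smooth hS, exists_motion hS, redField_projects hS⟩

end

/-! ### Hamiltonisation by the time change -/

section

open Matrix Filter Topology
variable {S : Params}

lemma _root_.HasDerivAt.phase_fst {c : ℝ → Phase d} {c' : Phase d} {s : ℝ}
    (h : HasDerivAt c c' s) : HasDerivAt (fun s => (c s).1) c'.1 s :=
  (hasFDerivAt_fst (p := c s)).comp_hasDerivAt s h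

lemma _root_.HasDerivAt.phase_snd {c : ℝ → Phase d} {c' : Phase d} {s : ℝ}
    (h : HasDerivAt c c' s) : HasDerivAt (fun s => (c s).2) c'.2 s :=
  (hasFDerivAt_snd (p := c s)).comp_hasDerivAt s h

/-- The square root of the multiplier, `dt / dτ`. -/
def timeScale (S : Params) (γ : Vec d) : ℝ := Real.sqrt (multiplier S γ)

lemma timeScale_pos (hS : S.Pos) {γ : Vec d} (hγ : γ ⬝ᵥ γ = 1) : 0 < timeScale S γ :=
  Real.sqrt_pos.mpr (multiplier_pos hS hγ)

lemma timeScale_sq (hS : S.Pos) {γ : Vec d} (hγ : γ ⬝ᵥ γ = 1) :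
    timeScale S γ ^ 2 = multiplier S γ :=
  Real.sq_sqrt (multiplier_pos hS hγ).le

/-- The Hamiltonian in the rescaled momenta. -/
lemma redHam_rescaled (hS : S.Pos) {γ : Vec d} (hγ : γ ⬝ᵥ γ = 1) (p : Vec d) :
    redHam S (γ, timeScale S γ • p) =
      1 / 2 * (p ⬝ᵥ p - axisInertia S * p (Fin.last d) ^ 2 / tiltInertia S γ)
        + S.m * S.g * S.ℓ * γ (Fin.last d) := by
  have hA := (multiplier_pos hS hγ).ne'
  have hB := (tiltInertia_pos hS hγ).ne'
  have h := timeScale_sq hS hγ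
  simp only [redHam, smul_dotProduct, dotProduct_smul, Pi.smul_apply, smul_eq_mul]
  field_simp
  rw [← h]
  ring

/-- Only `B` depends on the position in the kinetic energy, and `dB = 2 m b ℓ dγ_n`. The curve has
to stay in the cotangent bundle because the simplified formula for the Hamiltonian needs `A > 0`. -/
lemma hasDerivAt_redHam_rescaled (hS : S.Pos) {c : ℝ → Phase d} {c' : Phase d} {s₀ : ℝ}
    (hc : ∀ s, c s ∈ cotangentSphere d) (h : HasDerivAt c c' s₀) :
    HasDerivAt (fun s => redHam S ((c s).1, timeScale S (c s).1 • (c s).2))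
      ((c s₀).2 ⬝ᵥ c'.2
        - axisInertia S * (c s₀).2 (Fin.last d) * c'.2 (Fin.last d) / tiltInertia S (c s₀).1
        + S.m * S.b * S.ℓ * axisInertia S * (c s₀).2 (Fin.last d) ^ 2 * c'.1 (Fin.last d) /
          tiltInertia S (c s₀).1 ^ 2
        + S.m * S.g * S.ℓ * c'.1 (Fin.last d)) s₀ := by
  have hB := (tiltInertia_pos hS (hc s₀).1).ne'
  have h1 := h.phase_fst.vec_apply (Fin.last d)
  have h2 := h.phase_snd.vec_apply (Fin.last d)
  have hT : HasDerivAt (fun s => tiltInertia S (c s).1)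
      (S.m * (2 * S.b * S.ℓ * c'.1 (Fin.last d))) s₀ :=
    (((h1.const_mul (2 * S.b * S.ℓ)).const_add (S.b ^ 2 + S.ℓ ^ 2)).const_mul S.m).const_add
      (S.J₁ + S.Jₙ)
  have := (((h.phase_snd.dotProduct h.phase_snd).fun_sub
    (((h2.fun_pow 2).const_mul (axisInertia S)).fun_div hT hB)).const_mul (1 / 2 : ℝ)).fun_add
    (h1.const_mul (S.m * S.g * S.ℓ))
  refine (this.congr_of_eventuallyEq (.of_forall fun s =>
    redHam_rescaled hS (hc s).1 (c s).2)).congr_deriv ?_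
  rw [dotProduct_comm c'.2]
  push_cast
  field_simp
  ring

lemma hamiltonianAfter_timeScale (hS : S.Pos) :
    HamiltonianAfter (d := d) (redField S) (redHam S) (timeScale S) := by
  intro z t₀ t₁ θ τ₀ τ₁ hz hθ τ hτ
  obtain ⟨hθτ, hθ'⟩ := hθ τ hτ
  obtain ⟨⟨hγ, hp⟩, hz'⟩ := hz _ hθτ
  have hr := timeScale_pos hS hγ
  refine ⟨⟨hγ, by simp only [dotProduct_smul, hp, smul_zero]⟩, ?_⟩
  have hz1 : HasDerivAt (fun τ => (z (θ τ)).1) _ τ := hz'.phase_fst.scomp τ hθ'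
  have hz2 : HasDerivAt (fun τ => (z (θ τ)).2) _ τ := hz'.phase_snd.scomp τ hθ'
  have hρ := (hasDerivAt_multiplier S hz1).sqrt (multiplier_pos hS hγ).ne'
  have hρi := (hρ.fun_inv (timeScale_pos hS hγ).ne').fun_smul hz2
  refine ⟨_, hz1.prodMk hρi, fun c hc hcs hc0 => ?_⟩
  have hcd : HasDerivAt c (deriv c 0) 0 :=
    ((hc.differentiable (by simp)).differentiableAt).hasDerivAt
  refine (hasDerivAt_redHam_rescaled hS hcs hcd).congr_deriv ?_
  have hc1 : (c 0).1 ⬝ᵥ (deriv c 0).1 = 0 := by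
    have := (hcd.phase_fst.dotProduct hcd.phase_fst).unique
      ((hasDerivAt_const (0 : ℝ) (1 : ℝ)).congr_of_eventuallyEq (.of_forall fun s => (hcs s).1))
    rw [dotProduct_comm (deriv c 0).1] at this
    linarith
  -- Tangency to `γ · p = 0`; the scalar product of `γ` with the variation of the momentum is not
  -- zero.
  have hc2 : (c 0).1 ⬝ᵥ (deriv c 0).2 = -((c 0).2 ⬝ᵥ (deriv c 0).1) := by
    have := (hcd.phase_fst.dotProduct hcd.phase_snd).unique
      ((hasDerivAt_const (0 : ℝ) (0 : ℝ)).congr_of_eventuallyEq (.of_forall fun s => (hcs s).2))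
    rw [dotProduct_comm (deriv c 0).1] at this
    linarith
  rw [hc0] at hc1 hc2 ⊢
  dsimp only at hc1 hc2 ⊢
  generalize deriv c 0 = δ at *
  obtain ⟨δ₁, δ₂⟩ := δ
  generalize hγ_def : (z (θ τ)).1 = γ at *
  generalize hp_def : (z (θ τ)).2 = p at *
  have hA := (multiplier_pos hS hγ).ne'
  have hB := (tiltInertia_pos hS hγ).ne'
  have hsq := timeScale_sq hS hγ
  have hγe : δ₁ ⬝ᵥ γ = 0 := by rw [dotProduct_comm, hc1]
  have hpn := shapeVel_last p hA hB
  -- Replacing `p` by the Legendre image of the velocity `u`, and `A` by `r²`, reduces Hamilton's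
  -- equations to a rational identity in scalar products and last entries.
  have hpu : ∀ v : Vec d, p ⬝ᵥ v = multiplier S γ * (shapeVel S γ p ⬝ᵥ v) + axisInertia S *
      shapeVel S γ p (Fin.last d) * (v (Fin.last d) - γ (Fin.last d) * (γ ⬝ᵥ v)) := fun v => by
    conv_lhs => rw [← legendre_shapeVel hS hγ p]
    simp [legendre, add_dotProduct, sub_dotProduct, smul_dotProduct, eLast_dotProduct]
  rw [eq_div_iff hB, eq_comm] at hpn
  simp only [timeScale] at *
  simp only [symp, redField, hγ_def, hp_def, force]
  generalize shapeVel S γ p = u at *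
  generalize Real.sqrt (multiplier S γ) = r at *
  have h1 := hpu δ₁
  have h2 := hpu δ₂
  rw [hc1] at h1
  simp only [smul_dotProduct, smul_eq_mul] at hc2
  rw [hc2] at h2
  simp only [smul_dotProduct, dotProduct_smul, dotProduct_sub, dotProduct_add, smul_eq_mul,
    dotProduct_eLast, Pi.smul_apply, hγe, dotProduct_comm δ₁ p, dotProduct_comm δ₁ u, h2]
  rw [h1, hpn, ← hsq]
  field_simp
  ring

end

section

open Matrix Filter Topology
variable {S : Params}

/-! ### Derivatives of determinants -/

section det
variable {ι : Type*} [Fintype ι] [DecidableEq ι]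

/-- Jacobi's formula. The product rule in the Leibniz expansion replaces one column at a time by its
derivative, and by Cramer's rule these determinants are the diagonal entries of `adjugate M * M'`.
-/
lemma hasDerivAt_det {M : ℝ → Matrix ι ι ℝ} {M' : Matrix ι ι ℝ} {t : ℝ}
    (h : ∀ i j, HasDerivAt (fun s => M s i j) (M' i j) t) :
    HasDerivAt (fun s => (M s).det) (trace (adjugate (M t) * M')) t := by
  simp only [det_apply]
  have := HasDerivAt.fun_sum (u := Finset.univ) fun σ (_ : σ ∈ Finset.univ) =>
    (HasDerivAt.fun_finsetProd (u := Finset.univ) fun i (_ : i ∈ Finset.univ) =>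
      h (σ i) i).const_smul (Equiv.Perm.sign σ)
  refine this.congr_deriv ?_
  have hcol : ∀ i, (adjugate (M t) * M') i i = ((M t).updateCol i (M'.col i)).det := fun i => by
    rw [← cramer_apply, cramer_eq_adjugate_mulVec]
    rfl
  simp only [trace, diag_apply, hcol, det_apply, Finset.smul_sum]
  rw [Finset.sum_comm]
  refine Finset.sum_congr rfl fun i _ => Finset.sum_congr rfl fun σ _ => ?_
  congr 1
  rw [← Finset.mul_prod_erase _ _ (Finset.mem_univ i), updateCol_self, smul_eq_mul, mul_comm]
  congr 1
  refine Finset.prod_congr rfl fun j hj => ?_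
  rw [updateCol_ne (Finset.ne_of_mem_erase hj)]

/-- Liouville's formula. -/
lemma hasDerivAt_basis_det {V : Type*} [NormedAddCommGroup V] [NormedSpace ℝ V]
    [FiniteDimensional ℝ V] (b : Module.Basis ι ℝ V) (K : V →ₗ[ℝ] V) {Ψ : ι → ℝ → V} {t : ℝ}
    (h : ∀ j, HasDerivAt (Ψ j) (K (Ψ j t)) t) :
    HasDerivAt (fun s => b.det fun j => Ψ j s)
      (LinearMap.trace ℝ V K * b.det fun j => Ψ j t) t := by
  simp only [Module.Basis.det_apply]
  have hM : ∀ i j, HasDerivAt (fun s => b.toMatrix (fun j => Ψ j s) i j)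
      ((LinearMap.toMatrix b b K * b.toMatrix fun j => Ψ j t) i j) t := fun i j => by
    have h1 := (b.coord i).toContinuousLinearMap.hasFDerivAt.comp_hasDerivAt t (h j)
    refine h1.congr_deriv ?_
    exact (congrFun (LinearMap.toMatrix_mulVec_repr b b K (Ψ j t)) i).symm
  refine (hasDerivAt_det hM).congr_deriv ?_
  rw [trace_mul_comm, mul_assoc, mul_adjugate, Matrix.mul_smul, mul_one, trace_smul, smul_eq_mul,
    LinearMap.trace_eq_matrix_trace ℝ b, mul_comm]

end det

/-! ### The Liouville density as a determinant -/

/-- The canonical symplectic form as a bilinear form. -/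
def sympForm (d : ℕ) : LinearMap.BilinForm ℝ (Phase d) :=
  LinearMap.mk₂ ℝ symp
    (fun a b c => by simp [symp, add_dotProduct, dotProduct_add]; ring)
    (fun r a b => by simp [symp]; ring)
    (fun a b c => by simp [symp, add_dotProduct, dotProduct_add]; ring)
    (fun r a b => by simp [symp]; ring)

/-- The Gram matrix is `Pᵀ G P`, with `P` the coordinate matrix of the frame and `G` the Gram matrix
of the basis. -/
lemma det_symp_eq {ι : Type*} [Fintype ι] [DecidableEq ι] (b : Module.Basis ι ℝ (Phase d))
    (Ψ : ι → Phase d) : (of fun i j => symp (Ψ i) (Ψ j)).det =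
      (of fun i j => symp (b i) (b j)).det * b.det Ψ ^ 2 := by
  have : (of fun i j => symp (Ψ i) (Ψ j)) =
      (b.toMatrix Ψ)ᵀ * (of fun i j => symp (b i) (b j)) * b.toMatrix Ψ := by
    ext i j
    have h := LinearMap.sum_repr_mul_repr_mul b b (B := sympForm d) (Ψ i) (Ψ j)
    rw [Finsupp.sum_fintype _ _ (by simp)] at h
    have hs : ∀ k, ((b.repr (Ψ j)).sum fun l y => b.repr (Ψ i) k * (y * symp (b k) (b l))) =
        ∑ l, b.repr (Ψ i) k * (b.repr (Ψ j) l * symp (b k) (b l)) := fun k =>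
      Finsupp.sum_fintype _ _ (by simp)
    simp only [sympForm, LinearMap.mk₂_apply, smul_eq_mul, hs] at h
    simp only [mul_apply, transpose_apply, of_apply, Module.Basis.toMatrix_apply]
    rw [← h, Finset.sum_comm]
    refine Finset.sum_congr rfl fun k _ => ?_
    rw [Finset.sum_mul]
    exact Finset.sum_congr rfl fun l _ => by ring
  rw [this, det_mul, det_mul, det_transpose, Module.Basis.det_apply]
  ring

/-- A frame of `T*S^{n-1}` at `z`, completed by the Hamiltonian vector fields of `½ γ · γ` and
`γ · p`. -/
def completeFrame (z : Phase d) (w : Fin (2 * d) → Phase d) : Fin (2 * d) ⊕ Fin 2 → Phase d :=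
  Sum.elim w ![(0, z.1), (z.1, -z.2)]

/-- Tangent vectors are symplectically orthogonal to the two added vectors, which span a block of
determinant `1`. -/
lemma det_symp_completeFrame {z : Phase d} (hz : z ∈ cotangentSphere d)
    {w : Fin (2 * d) → Phase d} (h1 : ∀ i, z.1 ⬝ᵥ (w i).1 = 0)
    (h2 : ∀ i, z.1 ⬝ᵥ (w i).2 + z.2 ⬝ᵥ (w i).1 = 0) :
    (of fun i j => symp (completeFrame z w i) (completeFrame z w j)).det =
      (of fun i j => symp (w i) (w j)).det := by
  have h1' : ∀ i, (w i).1 ⬝ᵥ z.1 = 0 := fun i => by rw [dotProduct_comm, h1]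
  have h2' : ∀ i, (w i).1 ⬝ᵥ z.2 + z.1 ⬝ᵥ (w i).2 = 0 := fun i => by
    rw [dotProduct_comm, add_comm, h2]
  have : (of fun i j => symp (completeFrame z w i) (completeFrame z w j)) =
      fromBlocks (of fun i j => symp (w i) (w j)) 0 0 !![0, -1; 1, 0] := by
    ext (i | i) (j | j)
    · rfl
    · fin_cases j
      · simp [completeFrame, symp, h1']
      · simp only [completeFrame, symp, of_apply, Sum.elim_inl, Sum.elim_inr, fromBlocks_apply₁₂]
        simp [← neg_add', h2']
    · fin_cases i
      · simp [completeFrame, symp, h1']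
      · simp only [completeFrame, symp, of_apply, Sum.elim_inl, Sum.elim_inr, fromBlocks_apply₂₁]
        simp [add_comm (z.1 ⬝ᵥ (w j).2), h2']
    · have hp : z.2 ⬝ᵥ z.1 = 0 := by rw [dotProduct_comm, hz.2]
      fin_cases i <;> fin_cases j <;> simp [completeFrame, symp, hz.1, hz.2]
  rw [this, det_fromBlocks_zero₂₁]
  simp

/-- The density, intrinsic to the submanifold, becomes an ambient determinant times a constant, so
that Liouville's formula on a fixed vector space applies. -/
lemma liouville_eq (b : Module.Basis (Fin (2 * d) ⊕ Fin 2) ℝ (Phase d)) {z : Phase d}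
    (hz : z ∈ cotangentSphere d) {w : Fin (2 * d) → Phase d} (h1 : ∀ i, z.1 ⬝ᵥ (w i).1 = 0)
    (h2 : ∀ i, z.1 ⬝ᵥ (w i).2 + z.2 ⬝ᵥ (w i).1 = 0) :
    liouville w = |b.det (completeFrame z w)| * Real.sqrt (of fun i j => symp (b i) (b j)).det := by
  rw [liouville, ← det_symp_completeFrame hz h1 h2, det_symp_eq b, mul_comm,
    Real.sqrt_mul (sq_nonneg _), Real.sqrt_sq_eq_abs]

lemma exists_phase_basis (d : ℕ) :
    Nonempty (Module.Basis (Fin (2 * d) ⊕ Fin 2) ℝ (Phase d)) := by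
  have h : Module.finrank ℝ (Phase d) = Fintype.card (Fin (2 * d) ⊕ Fin 2) := by
    simp; ring
  exact ⟨(Module.finBasisOfFinrankEq ℝ (Phase d) h).reindex (Fintype.equivFin _).symm⟩

end

section

open Matrix Filter Topology
variable {S : Params}

/-! ### The linearisation of the reduced vector field -/

/-- The linear form `v ↦ u · v`. -/
def dotForm (u : Vec d) : Vec d →ₗ[ℝ] ℝ where
  toFun v := u ⬝ᵥ v
  map_add' := dotProduct_add u
  map_smul' c v := dotProduct_smul c u v

@[simp] lemma dotForm_apply (u v : Vec d) : dotForm u v = u ⬝ᵥ v := rfl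

/-- The linear form `v ↦ v_n`. -/
def lastForm (d : ℕ) : Vec d →ₗ[ℝ] ℝ := LinearMap.proj (Fin.last d)

@[simp] lemma lastForm_apply (v : Vec d) : lastForm d v = v (Fin.last d) := rfl

/-- The derivative of `shapeVel` in the direction of the momentum. -/
def velMomDeriv (S : Params) (γ : Vec d) : Vec d →ₗ[ℝ] Vec d :=
  (multiplier S γ)⁻¹ • LinearMap.id - (lastForm d).smulRight
    (((multiplier S γ)⁻¹ * (axisInertia S / tiltInertia S γ)) •
      (eLast d - γ (Fin.last d) • γ))

/-- The derivative of `shapeVel` in the direction of the position. -/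
def velPosDeriv (S : Params) (γ p : Vec d) : Vec d →ₗ[ℝ] Vec d :=
  ((multiplier S γ)⁻¹ * (axisInertia S * p (Fin.last d) / tiltInertia S γ) * γ (Fin.last d)) •
      LinearMap.id +
    (lastForm d).smulRight
      (((multiplier S γ)⁻¹ * (axisInertia S * p (Fin.last d) / tiltInertia S γ ^ 2) *
          (2 * (S.m * S.b * S.ℓ))) • (eLast d - γ (Fin.last d) • γ)
        + ((multiplier S γ)⁻¹ * (axisInertia S * p (Fin.last d) / tiltInertia S γ)) • γ
        - (2 * (axisInertia S * γ (Fin.last d) + S.m * S.b * S.ℓ) / multiplier S γ) •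
          shapeVel S γ p)

/-- The derivative of the first component of `redField`. -/
def fieldDerivFst (S : Params) (z : Phase d) : Phase d →ₗ[ℝ] Vec d :=
  velPosDeriv S z.1 z.2 ∘ₗ LinearMap.fst ℝ _ _ + velMomDeriv S z.1 ∘ₗ LinearMap.snd ℝ _ _

/-- The derivative of the second component of `redField`. -/
def fieldDerivSnd (S : Params) (z : Phase d) : Phase d →ₗ[ℝ] Vec d :=
  (S.m * S.b * S.ℓ) • (lastForm d ∘ₗ fieldDerivFst S z).smulRight (redField S z).1
    + (S.m * S.b * S.ℓ * (redField S z).1 (Fin.last d)) • fieldDerivFst S z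
    + (S.m * S.g * S.ℓ) • ((lastForm d ∘ₗ LinearMap.fst ℝ _ _).smulRight z.1
      + z.1 (Fin.last d) • LinearMap.fst ℝ _ _)
    - (dotForm (redField S z).1 ∘ₗ LinearMap.snd ℝ _ _ + dotForm z.2 ∘ₗ fieldDerivFst S z).smulRight
        z.1
    - (z.2 ⬝ᵥ (redField S z).1) • LinearMap.fst ℝ _ _

/-- The derivative of `redField`. -/
def fieldDeriv (S : Params) (z : Phase d) : Phase d →ₗ[ℝ] Phase d :=
  (fieldDerivFst S z).prod (fieldDerivSnd S z)

lemma fieldDeriv_apply (S : Params) (z v : Phase d) :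
    fieldDeriv S z v = (fieldDerivFst S z v, fieldDerivSnd S z v) := rfl

lemma fieldDerivFst_apply (S : Params) (z v : Phase d) :
    fieldDerivFst S z v = velPosDeriv S z.1 z.2 v.1 + velMomDeriv S z.1 v.2 := rfl

lemma fieldDerivSnd_apply (S : Params) (z v : Phase d) :
    fieldDerivSnd S z v =
      (S.m * S.b * S.ℓ) • (fieldDerivFst S z v (Fin.last d) • (redField S z).1)
      + (S.m * S.b * S.ℓ * (redField S z).1 (Fin.last d)) • fieldDerivFst S z v
      + (S.m * S.g * S.ℓ) • (v.1 (Fin.last d) • z.1 + z.1 (Fin.last d) • v.1)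
      - ((redField S z).1 ⬝ᵥ v.2 + z.2 ⬝ᵥ fieldDerivFst S z v) • z.1
      - (z.2 ⬝ᵥ (redField S z).1) • v.1 := rfl

lemma velMomDeriv_apply (S : Params) (γ v : Vec d) :
    velMomDeriv S γ v = (multiplier S γ)⁻¹ • v - v (Fin.last d) •
      (((multiplier S γ)⁻¹ * (axisInertia S / tiltInertia S γ)) •
        (eLast d - γ (Fin.last d) • γ)) := rfl

lemma velPosDeriv_apply (S : Params) (γ p v : Vec d) :
    velPosDeriv S γ p v =
      ((multiplier S γ)⁻¹ * (axisInertia S * p (Fin.last d) / tiltInertia S γ) *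
        γ (Fin.last d)) • v + v (Fin.last d) •
      (((multiplier S γ)⁻¹ * (axisInertia S * p (Fin.last d) / tiltInertia S γ ^ 2) *
          (2 * (S.m * S.b * S.ℓ))) • (eLast d - γ (Fin.last d) • γ)
        + ((multiplier S γ)⁻¹ * (axisInertia S * p (Fin.last d) / tiltInertia S γ)) • γ
        - (2 * (axisInertia S * γ (Fin.last d) + S.m * S.b * S.ℓ) / multiplier S γ) •
          shapeVel S γ p) := rfl

lemma hasDerivAt_shapeVel (hS : S.Pos) {c : ℝ → Phase d} {c' : Phase d} {t : ℝ}
    (hc : c t ∈ cotangentSphere d) (h : HasDerivAt c c' t) :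
    HasDerivAt (fun s => shapeVel S (c s).1 (c s).2) (fieldDerivFst S (c t) c') t := by
  have hA := (multiplier_pos hS hc.1).ne'
  have hB := (tiltInertia_pos hS hc.1).ne'
  have h1 := h.phase_fst.vec_apply (Fin.last d)
  have h2 := h.phase_snd.vec_apply (Fin.last d)
  have hT : HasDerivAt (fun s => tiltInertia S (c s).1)
      (2 * (S.m * S.b * S.ℓ) * c'.1 (Fin.last d)) t :=
    ((((h1.const_mul (2 * S.b * S.ℓ)).const_add (S.b ^ 2 + S.ℓ ^ 2)).const_mul S.m).const_add
      (S.J₁ + S.Jₙ)).congr_deriv (by ring)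
  refine (((hasDerivAt_multiplier S h.phase_fst).fun_inv hA).fun_smul
    (h.phase_snd.fun_sub (((h2.const_mul (axisInertia S)).fun_div hT hB).fun_smul
      ((h1.fun_smul h.phase_fst).const_sub (eLast d))))).congr_deriv ?_
  simp only [fieldDerivFst_apply, velPosDeriv_apply, velMomDeriv_apply, shapeVel]
  ext i
  simp only [Pi.add_apply, Pi.sub_apply, Pi.neg_apply, Pi.smul_apply, smul_eq_mul]
  field_simp
  ring

lemma hasDerivAt_redField (hS : S.Pos) {c : ℝ → Phase d} {c' : Phase d} {t : ℝ}
    (hc : c t ∈ cotangentSphere d) (h : HasDerivAt c c' t) :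
    HasDerivAt (fun s => redField S (c s)) (fieldDeriv S (c t) c') t := by
  have hw := hasDerivAt_shapeVel hS hc h
  have h1 := h.phase_fst.vec_apply (Fin.last d)
  refine hw.prodMk (((((hw.vec_apply (Fin.last d)).const_mul (S.m * S.b * S.ℓ)).fun_smul
    hw).fun_sub (((h1.fun_smul h.phase_fst).const_sub (eLast d)).const_smul (S.m * S.g * S.ℓ))
      ).fun_sub ((h.phase_snd.dotProduct hw).fun_smul h.phase_fst)) |>.congr_deriv ?_
  refine Prod.ext rfl ?_
  rw [fieldDeriv_apply, fieldDerivSnd_apply, dotProduct_comm c'.2]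
  dsimp only [redField]
  module

/-- The linear map which transports the tangent frames of `T*S^{n-1}` by the linearised flow and
the two normal vectors of `completeFrame` along the solution. -/
def transport (S : Params) (z : Phase d) : Phase d →ₗ[ℝ] Phase d :=
  fieldDeriv S z
    + (dotForm z.1 ∘ₗ LinearMap.fst ℝ _ _).smulRight
        (((redField S z).1, -(redField S z).2) - fieldDeriv S z (z.1, -z.2))
    + (dotForm z.1 ∘ₗ LinearMap.snd ℝ _ _ + dotForm z.2 ∘ₗ LinearMap.fst ℝ _ _).smulRight
        ((0, (redField S z).1) - fieldDeriv S z (0, z.1))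

/-- Split `f` over the two factors and use cyclicity of the trace. -/
lemma trace_eq_add_trace_blocks {V W : Type*} [AddCommGroup V] [Module ℝ V] [AddCommGroup W]
    [Module ℝ W] [FiniteDimensional ℝ V] [FiniteDimensional ℝ W] (f : V × W →ₗ[ℝ] V × W) :
    LinearMap.trace ℝ _ f =
      LinearMap.trace ℝ _ (LinearMap.fst ℝ V W ∘ₗ f ∘ₗ LinearMap.inl ℝ V W) +
      LinearMap.trace ℝ _ (LinearMap.snd ℝ V W ∘ₗ f ∘ₗ LinearMap.inr ℝ V W) := by
  have h : f = (f ∘ₗ LinearMap.inl ℝ V W) ∘ₗ LinearMap.fst ℝ V W +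
      (f ∘ₗ LinearMap.inr ℝ V W) ∘ₗ LinearMap.snd ℝ V W := by
    refine LinearMap.ext fun x => ?_
    simp [← map_add]
  conv_lhs => rw [h]
  rw [map_add, LinearMap.trace_comp_comm' (LinearMap.fst ℝ V W),
    LinearMap.trace_comp_comm' (LinearMap.snd ℝ V W)]

lemma trace_velMomDeriv (S : Params) (γ : Vec d) : LinearMap.trace ℝ _ (velMomDeriv S γ) =
    (multiplier S γ)⁻¹ * (d + 1) - (multiplier S γ)⁻¹ * (axisInertia S / tiltInertia S γ) *
      (1 - γ (Fin.last d) ^ 2) := by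
  simp only [velMomDeriv, map_sub, map_smul, LinearMap.trace_smulRight, LinearMap.trace_id,
    Module.finrank_fin_fun, lastForm_apply, smul_eq_mul, eLast_last]
  push_cast
  ring

lemma trace_velPosDeriv (S : Params) (γ p : Vec d) :
    LinearMap.trace ℝ _ (velPosDeriv S γ p) =
    (multiplier S γ)⁻¹ * (axisInertia S * p (Fin.last d) / tiltInertia S γ) * γ (Fin.last d) *
      (d + 2) + (multiplier S γ)⁻¹ * (axisInertia S * p (Fin.last d) / tiltInertia S γ ^ 2) *
          (2 * (S.m * S.b * S.ℓ)) * (1 - γ (Fin.last d) ^ 2)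
      - 2 * (axisInertia S * γ (Fin.last d) + S.m * S.b * S.ℓ) / multiplier S γ *
        shapeVel S γ p (Fin.last d) := by
  simp [velPosDeriv, LinearMap.trace_smulRight, eLast_last]
  ring

/-- Only the diagonal blocks count: the position derivative of the velocity, and the momentum
derivative of the force. Gravity depends on the position alone and drops out. -/
lemma trace_fieldDeriv (S : Params) (z : Phase d) :
    LinearMap.trace ℝ _ (fieldDeriv S z) = LinearMap.trace ℝ _ (velPosDeriv S z.1 z.2) +
      (S.m * S.b * S.ℓ * velMomDeriv S z.1 (redField S z).1 (Fin.last d) +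
        S.m * S.b * S.ℓ * (redField S z).1 (Fin.last d) * LinearMap.trace ℝ _ (velMomDeriv S z.1)
        - ((redField S z).1 ⬝ᵥ z.1 + z.2 ⬝ᵥ velMomDeriv S z.1 z.1)) := by
  have h1 : LinearMap.fst ℝ (Vec d) (Vec d) ∘ₗ fieldDeriv S z ∘ₗ LinearMap.inl ℝ _ _ =
      velPosDeriv S z.1 z.2 := by
    ext v i
    simp [fieldDeriv, fieldDerivFst]
  have h2 : LinearMap.snd ℝ (Vec d) (Vec d) ∘ₗ fieldDeriv S z ∘ₗ LinearMap.inr ℝ _ _ =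
      (S.m * S.b * S.ℓ) • (lastForm d ∘ₗ velMomDeriv S z.1).smulRight (redField S z).1
      + (S.m * S.b * S.ℓ * (redField S z).1 (Fin.last d)) • velMomDeriv S z.1
      - (dotForm (redField S z).1 + dotForm z.2 ∘ₗ velMomDeriv S z.1).smulRight z.1 := by
    refine LinearMap.ext fun v => ?_
    simp [fieldDeriv, fieldDerivSnd, fieldDerivFst]
  rw [trace_eq_add_trace_blocks, h1, h2]
  simp [LinearMap.trace_smulRight]

/-- As `Ȧ = 2 (C γ_n + m b ℓ) w_n`, the value is `(d - 1)/2` times the logarithmic derivative of `A`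
along the flow. -/
lemma trace_transport (hS : S.Pos) {z : Phase d} (hz : z ∈ cotangentSphere d) :
    LinearMap.trace ℝ _ (transport S z) =
      (d - 1) * (axisInertia S * z.1 (Fin.last d) + S.m * S.b * S.ℓ) *
        (redField S z).1 (Fin.last d) / multiplier S z.1 := by
  obtain ⟨γ, p⟩ := z
  obtain ⟨hγ, hp⟩ := hz
  dsimp only at hγ hp
  have hA := (multiplier_pos hS hγ).ne'
  have hB := (tiltInertia_pos hS hγ).ne'
  have hAB := tiltInertia_eq S γ
  have hpn := shapeVel_last p hA hB
  have hw := dotProduct_shapeVel (S := S) hγ hp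
  have hw' : shapeVel S γ p ⬝ᵥ γ = 0 := by rw [dotProduct_comm, hw]
  have hp' : p ⬝ᵥ γ = 0 := by rw [dotProduct_comm, hp]
  rw [eq_div_iff hB, eq_comm] at hpn
  simp only [transport, map_add, LinearMap.trace_smulRight, trace_fieldDeriv, trace_velPosDeriv,
    trace_velMomDeriv]
  simp only [LinearMap.add_apply, LinearMap.comp_apply, LinearMap.fst_apply, LinearMap.snd_apply,
    dotForm_apply, Prod.fst_sub, Prod.snd_sub, fieldDeriv_apply, fieldDerivSnd_apply,
    fieldDerivFst_apply, velPosDeriv_apply, velMomDeriv_apply, redField,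
    map_neg, dotProduct_add, dotProduct_sub, dotProduct_neg, dotProduct_smul, dotProduct_zero,
    dotProduct_eLast, Pi.add_apply, Pi.sub_apply, Pi.neg_apply, Pi.smul_apply, Pi.zero_apply,
    smul_eq_mul, eLast_last, hγ, hp, hp', hw, hw', hpn, smul_zero, zero_smul]
  generalize shapeVel S γ p (Fin.last d) = u at *
  generalize tiltInertia S γ = B at *
  generalize multiplier S γ = A at *
  field_simp
  rw [hAB]
  ring

end

section

open Matrix Filter Topology
variable {S : Params}

/-! ### The invariant measure -/

section variation
variable {E : Type*} [NormedAddCommGroup E] [NormedSpace ℝ E]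
  {t₀ t₁ : ℝ} {W : Set E} {F : ℝ × E → Phase d}

lemma hasDerivAt_line {s : ℝ} {u : E} (hF : DifferentiableAt ℝ F (s, u)) (e : E) :
    HasDerivAt (fun ε : ℝ => F (s, u + ε • e)) (fderiv ℝ F (s, u) (0, e)) 0 := by
  have h0 : HasDerivAt (fun ε : ℝ => (s, u + ε • e)) (0, e) 0 := by
    simpa using (hasDerivAt_const (0 : ℝ) s).prodMk
      (((hasDerivAt_id (0 : ℝ)).smul_const e).const_add u)
  have hF' : HasFDerivAt F (fderiv ℝ F (s, u)) (s, u + (0 : ℝ) • e) := by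
    simpa using hF.hasFDerivAt
  exact hF'.comp_hasDerivAt (0 : ℝ) h0

lemma eventually_line_mem (hW : IsOpen W) {u : E} (hu : u ∈ W) (e : E) :
    ∀ᶠ ε : ℝ in 𝓝 0, u + ε • e ∈ W := by
  have : Continuous fun ε : ℝ => u + ε • e := by fun_prop
  exact this.continuousAt (hW.mem_nhds (by simpa using hu))

/-- The variations of a family of solutions solve the linearised equations. -/
lemma hasDerivAt_variation (hS : S.Pos) (hW : IsOpen W)
    (hF : ContDiffOn ℝ ∞ F (Ioo t₀ t₁ ×ˢ W))
    (hsol : ∀ t ∈ Ioo t₀ t₁, ∀ u ∈ W, F (t, u) ∈ cotangentSphere d ∧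
      HasDerivAt (fun s => F (s, u)) (redField S (F (t, u))) t)
    {t : ℝ} (ht : t ∈ Ioo t₀ t₁) {u : E} (hu : u ∈ W) (e : E) :
    HasDerivAt (fun s => fderiv ℝ F (s, u) (0, e))
      (fieldDeriv S (F (t, u)) (fderiv ℝ F (t, u) (0, e))) t := by
  have hopen : IsOpen (Ioo t₀ t₁ ×ˢ W) := isOpen_Ioo.prod hW
  have hcd : ∀ s ∈ Ioo t₀ t₁, ∀ v ∈ W, ContDiffAt ℝ ∞ F (s, v) := fun s hs v hv =>
    hF.contDiffAt (hopen.mem_nhds ⟨hs, hv⟩)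
  have hdiff : ∀ s ∈ Ioo t₀ t₁, ∀ v ∈ W, DifferentiableAt ℝ F (s, v) := fun s hs v hv =>
    (hcd s hs v hv).differentiableAt (by simp)
  have hD : DifferentiableAt ℝ (fderiv ℝ F) (t, u) :=
    ((hcd t ht u hu).fderiv_right (m := 1) (by norm_cast)).differentiableAt (by simp)
  have hD2 := hD.hasFDerivAt
  set D2 := fderiv ℝ (fderiv ℝ F) (t, u)
  -- Symmetry of second derivatives exchanges the time and parameter derivatives; the time
  -- derivative of the family is the field itself.
  have hsymm : D2 (1, 0) (0, e) = D2 (0, e) (1, 0) :=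
    ((hcd t ht u hu).isSymmSndFDerivAt (by
      rw [minSmoothness_of_isRCLikeNormedField]; exact WithTop.coe_le_coe.mpr le_top)).eq _ _
  have htime : ∀ v ∈ W, fderiv ℝ F (t, v) (1, 0) = redField S (F (t, v)) := fun v hv => by
    have h0 : HasDerivAt (fun s : ℝ => (s, v)) ((1 : ℝ), (0 : E)) t :=
      (hasDerivAt_id t).prodMk (hasDerivAt_const t v)
    exact ((hdiff t ht v hv).hasFDerivAt.comp_hasDerivAt t h0).unique (hsol t ht v hv).2
  have h1 : HasDerivAt (fun s => fderiv ℝ F (s, u) (0, e)) (D2 (1, 0) (0, e)) t := by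
    have h0 : HasDerivAt (fun s : ℝ => (s, u)) ((1 : ℝ), (0 : E)) t :=
      (hasDerivAt_id t).prodMk (hasDerivAt_const t u)
    exact (ContinuousLinearMap.apply ℝ (Phase d) ((0 : ℝ), e)).hasFDerivAt.comp_hasDerivAt t
      (hD2.comp_hasDerivAt t h0)
  have h2 : HasDerivAt (fun ε : ℝ => fderiv ℝ F (t, u + ε • e) (1, 0)) (D2 (0, e) (1, 0)) 0 := by
    have h0 : HasDerivAt (fun ε : ℝ => (t, u + ε • e)) (0, e) 0 := by
      simpa using (hasDerivAt_const (0 : ℝ) t).prodMk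
        (((hasDerivAt_id (0 : ℝ)).smul_const e).const_add u)
    have hD2' : HasFDerivAt (fderiv ℝ F) D2 (t, u + (0 : ℝ) • e) := by simpa using hD2
    exact (ContinuousLinearMap.apply ℝ (Phase d) ((1 : ℝ), (0 : E))).hasFDerivAt.comp_hasDerivAt
      (0 : ℝ) (hD2'.comp_hasDerivAt (0 : ℝ) h0)
  have h3 : HasDerivAt (fun ε : ℝ => redField S (F (t, u + ε • e)))
      (fieldDeriv S (F (t, u)) (fderiv ℝ F (t, u) (0, e))) 0 := by
    have := hasDerivAt_redField hS (c := fun ε : ℝ => F (t, u + ε • e)) (t := 0)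
      (by simpa using (hsol t ht u hu).1) (hasDerivAt_line (hdiff t ht u hu) e)
    simpa using this
  have h4 := h2.unique (h3.congr_of_eventuallyEq
    ((eventually_line_mem hW hu e).mono fun ε hε => htime _ hε))
  rwa [hsymm, h4] at h1

/-- The variations of a family of points of `T*S^{n-1}` are tangent to it. -/
lemma variation_tangent (hW : IsOpen W) {t : ℝ} (hsol : ∀ u ∈ W, F (t, u) ∈ cotangentSphere d)
    {u : E} (hu : u ∈ W) (hF : DifferentiableAt ℝ F (t, u)) (e : E) :
    (F (t, u)).1 ⬝ᵥ (fderiv ℝ F (t, u) (0, e)).1 = 0 ∧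
    (F (t, u)).1 ⬝ᵥ (fderiv ℝ F (t, u) (0, e)).2 +
      (F (t, u)).2 ⬝ᵥ (fderiv ℝ F (t, u) (0, e)).1 = 0 := by
  have h := hasDerivAt_line hF e
  have hmem := (eventually_line_mem hW hu e).mono fun ε hε => hsol _ hε
  have h1 := (h.phase_fst.dotProduct h.phase_fst).unique
    ((hasDerivAt_const (0 : ℝ) (1 : ℝ)).congr_of_eventuallyEq (hmem.mono fun _ h => h.1))
  have h2 := (h.phase_fst.dotProduct h.phase_snd).unique
    ((hasDerivAt_const (0 : ℝ) (0 : ℝ)).congr_of_eventuallyEq (hmem.mono fun _ h => h.2))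
  simp only [zero_smul, add_zero] at h1 h2
  rw [dotProduct_comm (fderiv ℝ F (t, u) (0, e)).1] at h1 h2
  constructor <;> linarith

end variation

/-- The two forms in `transport` are the differentials of `½ γ · γ` and `γ · p`. They vanish on
tangent vectors and are dual to the two normal vectors, so each correction acts on one normal vector
and replaces its linearised image by its true velocity. -/
lemma hasDerivAt_completeFrame {z : ℝ → Phase d} {w : Fin (2 * d) → ℝ → Phase d} {t : ℝ}
    (hz : z t ∈ cotangentSphere d) (hz' : HasDerivAt z (redField S (z t)) t)
    (hw : ∀ i, HasDerivAt (w i) (fieldDeriv S (z t) (w i t)) t)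
    (h1 : ∀ i, (z t).1 ⬝ᵥ (w i t).1 = 0)
    (h2 : ∀ i, (z t).1 ⬝ᵥ (w i t).2 + (z t).2 ⬝ᵥ (w i t).1 = 0) (j : Fin (2 * d) ⊕ Fin 2) :
    HasDerivAt (fun s => completeFrame (z s) (fun i => w i s) j)
      (transport S (z t) (completeFrame (z t) (fun i => w i t) j)) t := by
  have htr : ∀ v, transport S (z t) v = fieldDeriv S (z t) v
      + ((z t).1 ⬝ᵥ v.1) • (((redField S (z t)).1, -(redField S (z t)).2)
          - fieldDeriv S (z t) ((z t).1, -(z t).2))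
      + ((z t).1 ⬝ᵥ v.2 + (z t).2 ⬝ᵥ v.1) •
          ((0, (redField S (z t)).1) - fieldDeriv S (z t) (0, (z t).1)) := fun v => rfl
  have hp : (z t).2 ⬝ᵥ (z t).1 = 0 := by rw [dotProduct_comm, hz.2]
  rw [htr]
  rcases j with i | j
  · simpa [completeFrame, h1, h2] using hw i
  · fin_cases j
    · refine ((hasDerivAt_const t (0 : Vec d)).prodMk hz'.phase_fst).congr_deriv ?_
      simp [completeFrame, hz.1]
    · refine (hz'.phase_fst.prodMk hz'.phase_snd.fun_neg).congr_deriv ?_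
      simp [completeFrame, hz.1, hz.2, hp]

lemma preservesMeasure_redField (hS : S.Pos) : PreservesMeasure (d := d) (redField S)
    (fun z => multiplier S z.1 ^ ((2 - ((d + 1 : ℕ) : ℝ)) / 2)) := by
  intro t₀ t₁ W F hW hF hsol t ht t' ht' u hu
  obtain ⟨b⟩ := exists_phase_basis d
  have hdiff : ∀ s ∈ Ioo t₀ t₁, DifferentiableAt ℝ F (s, u) := fun s hs =>
    (hF.contDiffAt ((isOpen_Ioo.prod hW).mem_nhds ⟨hs, hu⟩)).differentiableAt (by simp)
  set w : Fin (2 * d) → ℝ → Phase d := fun i s => fderiv ℝ F (s, u) (0, Pi.single i 1)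
  set z : ℝ → Phase d := fun s => F (s, u)
  have hpart : ∀ s ∈ Ioo t₀ t₁,
      (fun i => fderiv ℝ (fun u' => F (s, u')) u (Pi.single i 1)) = fun i => w i s := by
    intro s hs
    have h0 : HasFDerivAt (fun u' : Fin (2 * d) → ℝ => (s, u')) (ContinuousLinearMap.inr ℝ ℝ _) u :=
      hasFDerivAt_prodMk_right s u
    funext i
    have hc : HasFDerivAt (fun u' => F (s, u')) _ u := (hdiff s hs).hasFDerivAt.comp u h0
    rw [hc.fderiv]
    rfl
  have hz : ∀ s ∈ Ioo t₀ t₁, z s ∈ cotangentSphere d := fun s hs => (hsol s hs u hu).1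
  have hz' : ∀ s ∈ Ioo t₀ t₁, HasDerivAt z (redField S (z s)) s := fun s hs => (hsol s hs u hu).2
  have htan : ∀ s ∈ Ioo t₀ t₁, ∀ i, (z s).1 ⬝ᵥ (w i s).1 = 0 ∧
      (z s).1 ⬝ᵥ (w i s).2 + (z s).2 ⬝ᵥ (w i s).1 = 0 := fun s hs i =>
    variation_tangent hW (fun v hv => (hsol s hs v hv).1) hu (hdiff s hs) _
  -- The signed determinant is differentiable, unlike its absolute value. The absolute value is
  -- taken only once `A ^ ((1 - d) / 2) * D` is known to be constant.
  set D : ℝ → ℝ := fun s => b.det fun j => completeFrame (z s) (fun i => w i s) j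
  have hD : ∀ s ∈ Ioo t₀ t₁, HasDerivAt D (LinearMap.trace ℝ _ (transport S (z s)) * D s) s :=
    fun s hs => hasDerivAt_basis_det b _ fun j =>
      hasDerivAt_completeFrame (hz s hs) (hz' s hs)
        (fun i => hasDerivAt_variation hS hW hF hsol hs hu _)
        (fun i => (htan s hs i).1) (fun i => (htan s hs i).2) j
  have hconst : ∀ s ∈ Ioo t₀ t₁, HasDerivAt
      (fun s => multiplier S (z s).1 ^ ((2 - ((d + 1 : ℕ) : ℝ)) / 2) * D s) 0 s := by
    intro s hs
    have hA := multiplier_pos hS (hz s hs).1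
    have hf := (hasDerivAt_multiplier S (hz' s hs).phase_fst).rpow_const
      (p := (2 - ((d + 1 : ℕ) : ℝ)) / 2) (Or.inl hA.ne')
    refine (hf.fun_mul (hD s hs)).congr_deriv ?_
    rw [trace_transport hS (hz s hs), Real.rpow_sub_one hA.ne']
    push_cast
    field_simp
    ring
  have heq := eq_of_hasDerivAt_zero hconst ht ht'
  have hdens : ∀ s ∈ Ioo t₀ t₁,
      multiplier S (z s).1 ^ ((2 - ((d + 1 : ℕ) : ℝ)) / 2) * liouville (fun i => w i s) =
        |multiplier S (z s).1 ^ ((2 - ((d + 1 : ℕ) : ℝ)) / 2) * D s| *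
          Real.sqrt (of fun i j => symp (b i) (b j)).det := by
    intro s hs
    rw [liouville_eq b (hz s hs) (fun i => (htan s hs i).1) (fun i => (htan s hs i).2), abs_mul,
      abs_of_nonneg (Real.rpow_nonneg (multiplier_pos hS (hz s hs).1).le _), mul_assoc]
  rw [hpart t ht, hpart t' ht']
  exact (hdens t ht).trans ((by rw [heq] : _ = _).trans (hdens t' ht').symm)

end

end RubberRouth

end

theorem corollary4p3 (d : ℕ) (hd : 2 ≤ d) (S : RubberRouth.Params)
    (hb : 0 < S.b) (hm : 0 < S.m) (hℓ : 0 ≤ S.ℓ) (hJ₁ : 0 < S.J₁) (hJₙ : 0 < S.Jₙ) :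
    ∃ (X : RubberRouth.Phase d → RubberRouth.Phase d) (H : RubberRouth.Phase d → ℝ),
      RubberRouth.IsReducedVectorField S X ∧
      RubberRouth.IsReducedHamiltonian S H ∧
      RubberRouth.PreservesMeasure X
        (fun z => RubberRouth.multiplier S z.1 ^ ((2 - ((d + 1 : ℕ) : ℝ)) / 2)) ∧
      RubberRouth.HamiltonianAfter X H
        (fun γ => Real.sqrt (RubberRouth.multiplier S γ)) :=
  have hS : S.Pos := ⟨hb, hm, hℓ, hJ₁, hJₙ⟩
  ⟨RubberRouth.redField S, RubberRouth.redHam S, RubberRouth.isReducedVectorField_redField hS,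
    RubberRouth.isReducedHamiltonian_redHam hS, RubberRouth.preservesMeasure_redField hS,
    RubberRouth.hamiltonianAfter_timeScale hS⟩
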